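/- An L-shape with parameters $\ell_x,\ell_y,w_x,w_y$, where $0<w_x\le \ell_x\le 1$ and $0<w_y\le \ell_y\le 1$, is the union of an axis-parallel rectangle of width $\ell_x$ and height $w_y$ and an axis-parallel rectangle of width $w_x$ and height $\ell_y$ whose lower left corners coincide; $\ell_x,\ell_y$ are its arm lengths. Sequences of L-shapes are packed by translation, so that the interiors of distinct L-shapes are disjoint. A (deterministic) online algorithm places each L-shape irrevocably, knowing only that L-shape and the earlier ones. In strip packing the container is $[0,\infty)\times[0,1]$ and the cost is the maximum $x$-coordinate of an occupied point; in perimeter packing and in area packing the container is the plane and the cost is the perimeter, respectively the area, of the axis-parallel bounding box of the packing. For a finite sequence $I$ of $|I|$ L-shapes let $\mathrm{OPT}(I)$ be the optimal (infimum) offline cost and $\mathcal A(I)$ the cost of algorithm $\mathcal A$. For $f:\mathbb N\to\mathbb R$, $\mathcal A$ has (absolute) competitive ratio $f(n)$ if $\mathcal A(I)\le f(|I|)\cdot\mathrm{OPT}(I)$ for all $I$, and asymptotic competitive ratio $f(n)$ if there is a constant $\beta>0$ with $\mathcal A(I)\le f(|I|)\cdot \mathrm{OPT}(I)+\beta$ for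 all $I$. The online critical packing density for arm lengths bounded by $t$ is the supremum of all $A\ge 0$ such that some online algorithm packs every sequence of L-shapes with arm lengths at most $t$ and total area at most $A$ into the unit square $[0,1]^2$. Then: (i) The asymptotic competitive ratio of any online algorithm for strip packing of L-shapes is in $\Omega(n/\log n)$: there is a constant $c>0$ such that, whenever an online algorithm has asymptotic competitive ratio $f(n)$, one has $f(n)\ge c\,n/\log n$ for all sufficiently large $n$. (ii) There is an online algorithm for perimeter packing of L-shapes with absolute competitive ratio in $O(1)$. (iii) There is an online algorithm for area packing of L-shapes with asymptotic competitive ratio in $O(\sqrt n)$. (iv) For every $t<1$ the online critical packing density for arm lengths bounded by $t$ is positive, and for $t=1$ it is $0$. -/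

import Mathlib

open scoped NNReal ENNReal

/-- An L-shape with arm lengths at most `1`, up to translation: the union of an `lx × wy`
rectangle and a `wx × ly` rectangle with common lower left corner.  Arms have positive
thickness; rectangles (`wx = lx` or `wy = ly`) are allowed. -/
structure LShape where
  lx : ℝ
  ly : ℝ
  wx : ℝ
  wy : ℝ
  wx_pos : 0 < wx
  wy_pos : 0 < wy
  wx_le : wx ≤ lx
  wy_le : wy ≤ ly
  lx_le_one : lx ≤ 1
  ly_le_one : ly ≤ 1

namespace LShape

/-- The closed region covered by `L` when its lower left corner is placed at `p`. -/
def region (L : LShape) (p : ℝ × ℝ) : Set (ℝ × ℝ) :=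
  Set.Icc p.1 (p.1 + L.lx) ×ˢ Set.Icc p.2 (p.2 + L.wy) ∪
    Set.Icc p.1 (p.1 + L.wx) ×ˢ Set.Icc p.2 (p.2 + L.ly)

/-- The area of an L-shape. -/
def area (L : LShape) : ℝ := L.lx * L.wy + L.wx * L.ly - L.wx * L.wy

end LShape

namespace LPacking

/-- `P` is a packing by translation of the sequence `σ` into the container `C`, the `i`-th
object having its lower left corner at `P i`: every object lies in `C`, and distinct objects
have disjoint interiors (they may touch). -/
def IsPacking (C : Set (ℝ × ℝ)) (σ : List LShape) (P : Fin σ.length → ℝ × ℝ) : Prop :=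
  (∀ i, (σ.get i).region (P i) ⊆ C) ∧
    Pairwise fun i j =>
      Disjoint (interior ((σ.get i).region (P i))) (interior ((σ.get j).region (P j)))

/-- The set of points occupied by the sequence `σ` placed at `P`. -/
def occupied (σ : List LShape) (P : Fin σ.length → ℝ × ℝ) : Set (ℝ × ℝ) :=
  ⋃ i, (σ.get i).region (P i)

/-- A deterministic online algorithm: given the sequence of objects presented so far, it
returns the position of the last one.  Thus the position of an object depends only on that
object and the earlier ones, and is never revised. -/
abbrev OnlineAlgorithm := List LShape → ℝ × ℝ

/-- The positions that the online algorithm assigns to the objects of the sequence `σ`. -/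
def OnlineAlgorithm.run (𝒜 : OnlineAlgorithm) (σ : List LShape) : Fin σ.length → ℝ × ℝ :=
  fun i => 𝒜 (σ.take (i + 1))

/-- A packing variant: the container, and the cost of a packing as a function of the set of
occupied points, to be minimized. -/
structure Variant where
  container : Set (ℝ × ℝ)
  cost : Set (ℝ × ℝ) → ℝ

/-- The width of the bounding box of `S` (zero for the empty set). -/
noncomputable def bbWidth (S : Set (ℝ × ℝ)) : ℝ := sSup (Prod.fst '' S) - sInf (Prod.fst '' S)

/-- The height of the bounding box of `S` (zero for the empty set). -/
noncomputable def bbHeight (S : Set (ℝ × ℝ)) : ℝ := sSup (Prod.snd '' S) - sInf (Prod.snd '' S)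

/-- Strip packing: the container is the horizontal strip `[0, ∞) × [0, 1]`, the cost is the
maximum `x`-coordinate of an occupied point. -/
noncomputable def stripPack : Variant where
  container := Set.Ici 0 ×ˢ Set.Icc 0 1
  cost S := sSup (Prod.fst '' S)

/-- Perimeter packing: place in the plane, minimizing the perimeter of the bounding box. -/
noncomputable def periPack : Variant where
  container := Set.univ
  cost S := 2 * (bbWidth S + bbHeight S)

/-- Area packing: place in the plane, minimizing the area of the bounding box. -/
noncomputable def areaPack : Variant where
  container := Set.univ
  cost S := bbWidth S * bbHeight S

namespace Variant

/-- The offline optimum for the sequence `σ`. -/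
noncomputable def opt (V : Variant) (σ : List LShape) : ℝ :=
  sInf {c | ∃ P, IsPacking V.container σ P ∧ c = V.cost (occupied σ P)}

/-- `𝒜` is an online algorithm for the variant `V`: it packs every sequence. -/
def Solves (V : Variant) (𝒜 : OnlineAlgorithm) : Prop :=
  ∀ σ, IsPacking V.container σ (𝒜.run σ)

/-- The cost of the packing that `𝒜` computes for the sequence `σ`. -/
noncomputable def algCost (V : Variant) (𝒜 : OnlineAlgorithm) (σ : List LShape) : ℝ :=
  V.cost (occupied σ (𝒜.run σ))

/-- `𝒜` has (absolute) competitive ratio `f(n)`, with `n` the number of objects. -/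
def HasCompetitiveRatio (V : Variant) (𝒜 : OnlineAlgorithm) (f : ℕ → ℝ) : Prop :=
  ∀ σ, V.algCost 𝒜 σ ≤ f σ.length * V.opt σ

/-- `𝒜` has asymptotic competitive ratio `f(n)`, with `n` the number of objects. -/
def HasAsymptoticCompetitiveRatio (V : Variant) (𝒜 : OnlineAlgorithm) (f : ℕ → ℝ) : Prop :=
  ∃ β : ℝ, 0 < β ∧ ∀ σ, V.algCost 𝒜 σ ≤ f σ.length * V.opt σ + β

end Variant

/-- `𝒜` packs into the unit square every sequence of L-shapes with arm lengths at most `t`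
and total area at most `A`. -/
def PacksUnitSquare (𝒜 : OnlineAlgorithm) (t A : ℝ) : Prop :=
  ∀ σ : List LShape, (∀ L ∈ σ, L.lx ≤ t ∧ L.ly ≤ t) → (σ.map LShape.area).sum ≤ A →
    IsPacking (Set.Icc 0 1 ×ˢ Set.Icc 0 1) σ (𝒜.run σ)

/-- The online critical packing density of the unit square for L-shapes with arm lengths at
most `t`: the supremum of the `A` such that some online algorithm packs every sequence of
total area at most `A`.  (If `t ≤ 0` there are no such L-shapes and the value is `∞`.) -/
noncomputable def onlineCriticalDensity (t : ℝ) : ℝ≥0∞ :=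
  ⨆ A ∈ {A : ℝ≥0 | ∃ 𝒜 : OnlineAlgorithm, PacksUnitSquare 𝒜 t A}, (A : ℝ≥0∞)

end LPacking

namespace LShape

/-! ### Elementary geometry of L-shapes -/

theorem lx_pos (L : LShape) : 0 < L.lx := L.wx_pos.trans_le L.wx_le

theorem ly_pos (L : LShape) : 0 < L.ly := L.wy_pos.trans_le L.wy_le

theorem area_pos (L : LShape) : 0 < L.area := by
  have h := mul_le_mul_of_nonneg_left L.wy_le L.wx_pos.le
  have h2 := mul_pos L.lx_pos L.wy_pos
  unfold area; linarith

theorem wx_mul_ly_le_area (L : LShape) : L.wx * L.ly ≤ L.area := by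
  have h := mul_le_mul_of_nonneg_right L.wx_le L.wy_pos.le
  unfold area; linarith

theorem lx_mul_wy_le_area (L : LShape) : L.lx * L.wy ≤ L.area := by
  have h := mul_le_mul_of_nonneg_left L.wy_le L.wx_pos.le
  unfold area; linarith

theorem region_subset_quadrant (L : LShape) (p : ℝ × ℝ) :
    L.region p ⊆ Set.Ici p.1 ×ˢ Set.Ici p.2 := by
  rintro ⟨x, y⟩ (h | h) <;> exact ⟨h.1.1, h.2.1⟩

theorem region_subset_box (L : LShape) (p : ℝ × ℝ) :
    L.region p ⊆ Set.Icc p.1 (p.1 + L.lx) ×ˢ Set.Icc p.2 (p.2 + L.ly) := by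
  rintro ⟨x, y⟩ (h | h)
  · exact ⟨h.1, h.2.1, h.2.2.trans (by have := L.wy_le; linarith)⟩
  · exact ⟨⟨h.1.1, h.1.2.trans (by have := L.wx_le; linarith)⟩, h.2⟩

theorem corner_mem_region (L : LShape) (p : ℝ × ℝ) : p ∈ L.region p := by
  have := L.lx_pos; have := L.wy_pos
  exact Or.inl ⟨⟨le_rfl, by linarith⟩, ⟨le_rfl, by linarith⟩⟩

theorem right_mem_region (L : LShape) (p : ℝ × ℝ) : (p.1 + L.lx, p.2) ∈ L.region p := by
  have := L.lx_pos; have := L.wy_pos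
  exact Or.inl ⟨⟨by simp only; linarith, le_rfl⟩, ⟨le_rfl, by simp only; linarith⟩⟩

theorem top_mem_region (L : LShape) (p : ℝ × ℝ) : (p.1, p.2 + L.ly) ∈ L.region p := by
  have := L.ly_pos; have := L.wx_pos
  exact Or.inr ⟨⟨le_rfl, by simp only; linarith⟩, ⟨by simp only; linarith, le_rfl⟩⟩

theorem foot_subset_interior (L : LShape) (p : ℝ × ℝ) :
    Set.Ioo p.1 (p.1 + L.lx) ×ˢ Set.Ioo p.2 (p.2 + L.wy) ⊆ interior (L.region p) :=
  interior_maximal (fun _ h => Or.inl ⟨Set.Ioo_subset_Icc_self h.1, Set.Ioo_subset_Icc_self h.2⟩)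
    (isOpen_Ioo.prod isOpen_Ioo)

theorem spine_subset_interior (L : LShape) (p : ℝ × ℝ) :
    Set.Ioo p.1 (p.1 + L.wx) ×ˢ Set.Ioo p.2 (p.2 + L.ly) ⊆ interior (L.region p) :=
  interior_maximal (fun _ h => Or.inr ⟨Set.Ioo_subset_Icc_self h.1, Set.Ioo_subset_Icc_self h.2⟩)
    (isOpen_Ioo.prod isOpen_Ioo)

end LShape

/-! ### Separation of shapes, and online algorithms from causal placement rules -/

namespace LPacking

/-- The data of an L-shape as four bare numbers, so that arms may have thickness zero. -/
structure Profile where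
  lx : ℝ
  ly : ℝ
  wx : ℝ
  wy : ℝ

/-- The profile of an L-shape. -/
def profile (L : LShape) : Profile := ⟨L.lx, L.ly, L.wx, L.wy⟩

/-- A shape with profile `s` at `p` lies left of, below, or in the outer nesting position of
everything in the quadrant with corner `q`. -/
def Precedes (s : Profile) (p q : ℝ × ℝ) : Prop :=
  p.1 + s.lx ≤ q.1 ∨ p.2 + s.ly ≤ q.2 ∨ (p.1 + s.wx ≤ q.1 ∧ p.2 + s.wy ≤ q.2)

theorem Precedes.translate {s : Profile} {p q : ℝ × ℝ} (h : Precedes s p q) (v : ℝ × ℝ) :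
    Precedes s (v + p) (v + q) := by
  unfold Precedes at *
  simp only [Prod.fst_add, Prod.snd_add]
  rcases h with h | h | ⟨h, h'⟩
  · left; linarith
  · right; left; linarith
  · right; right; constructor <;> linarith

/-- The interior of `K` lies in the open quadrant at `q`, and each alternative keeps both rectangles
of `L` out of it. In the nesting case the foot stays below the quadrant and the spine to its left.
-/
theorem Precedes.disjoint_interior {L K : LShape} {p q : ℝ × ℝ} (h : Precedes (profile L) p q) :
    Disjoint (interior (L.region p)) (interior (K.region q)) := by
  have hK : interior (K.region q) ⊆ Set.Ioi q.1 ×ˢ Set.Ioi q.2 := by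
    refine (interior_mono (K.region_subset_quadrant q)).trans ?_
    rw [interior_prod_eq, interior_Ici, interior_Ici]
  rw [Set.disjoint_left]
  rintro ⟨x, y⟩ h1 h2
  have h1 := interior_subset h1
  have h2 := hK h2
  have hx : q.1 < x := h2.1
  have hy : q.2 < y := h2.2
  have hb := L.region_subset_box p h1
  have hbx : x ≤ p.1 + L.lx := hb.1.2
  have hby : y ≤ p.2 + L.ly := hb.2.2
  rcases h with h | h | ⟨h, h'⟩
  · simp only [profile] at h; linarith
  · simp only [profile] at h; linarith
  · simp only [profile] at h h'
    rcases h1 with h1 | h1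
    · have : y ≤ p.2 + L.wy := h1.2.2
      linarith
    · have : x ≤ p.1 + L.wx := h1.1.2
      linarith

/-- The online algorithm that places the `i`-th object of the sequence `s` at `F s i`. -/
noncomputable def ofSeq (F : (ℕ → LShape) → ℕ → ℝ × ℝ) : OnlineAlgorithm := fun σ =>
  F (fun j => σ.getD j ⟨1, 1, 1, 1, one_pos, one_pos, le_rfl, le_rfl, le_rfl, le_rfl⟩)
    (σ.length - 1)

/-- The sequence of objects of a list, padded with unit squares. -/
def seq (σ : List LShape) : ℕ → LShape := fun j =>
  σ.getD j ⟨1, 1, 1, 1, one_pos, one_pos, le_rfl, le_rfl, le_rfl, le_rfl⟩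

theorem seq_eq_get (σ : List LShape) (i : Fin σ.length) : seq σ i = σ.get i := by
  simp [seq]

/-- `F s i` depends only on the terms of `s` up to the `i`-th. -/
def Causal {α β : Type*} (F : (ℕ → α) → ℕ → β) : Prop :=
  ∀ s s' i, (∀ j ≤ i, s j = s' j) → F s i = F s' i

/-- By causality the padding is never seen, so running on prefixes agrees with evaluating on the
whole padded sequence. -/
theorem run_ofSeq {F : (ℕ → LShape) → ℕ → ℝ × ℝ} (hF : Causal F) (σ : List LShape)
    (i : Fin σ.length) : (ofSeq F).run σ i = F (seq σ) i := by
  have hl : (σ.take (i + 1)).length - 1 = i := by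
    have := i.2
    simp only [List.length_take]; omega
  unfold OnlineAlgorithm.run ofSeq
  rw [hl]
  refine hF _ _ _ fun j hj => ?_
  have := i.2
  simp only [seq]
  rw [List.getD_eq_getElem _ _ (by simp; omega), List.getD_eq_getElem _ _ (by omega)]
  simp

theorem sum_area_eq (σ : List LShape) :
    (σ.map LShape.area).sum = ∑ j ∈ Finset.range σ.length, (seq σ j).area := by
  rw [Finset.sum_range]
  simp_rw [seq_eq_get]
  rw [← List.sum_ofFn]
  congr 1
  apply List.ext_getElem <;> simp

/-- A placement rule whose positions are pairwise separated yields packings. -/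
theorem isPacking_ofSeq {F : (ℕ → LShape) → ℕ → ℝ × ℝ} (hF : Causal F) (C : Set (ℝ × ℝ))
    (σ : List LShape) (hC : ∀ i < σ.length, (seq σ i).region (F (seq σ) i) ⊆ C)
    (hsep : ∀ j < σ.length, ∀ i < j, Precedes (profile (seq σ i)) (F (seq σ) i) (F (seq σ) j) ∨
      Precedes (profile (seq σ j)) (F (seq σ) j) (F (seq σ) i)) :
    IsPacking C σ ((ofSeq F).run σ) := by
  have key : ∀ i j : Fin σ.length, (i : ℕ) < j →
      Disjoint (interior ((σ.get i).region ((ofSeq F).run σ i)))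
        (interior ((σ.get j).region ((ofSeq F).run σ j))) := by
    intro i j hij
    rw [run_ofSeq hF, run_ofSeq hF, ← seq_eq_get, ← seq_eq_get]
    rcases hsep j j.2 i hij with h | h
    · exact h.disjoint_interior
    · exact h.disjoint_interior.symm
  refine ⟨fun i => ?_, fun i j hij => ?_⟩
  · rw [run_ofSeq hF, ← seq_eq_get]; exact hC i i.2
  · rcases lt_or_gt_of_ne (fun h => hij (Fin.ext h) : (i : ℕ) ≠ j) with h | h
    · exact key i j h
    · exact (key j i h).symm

end LPacking

/-! ### The lower bound for strip packing -/

namespace LPacking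

/-- The deadlines of the adversarial shapes: `(1/4) 3^(-(2^n - t))`. -/
noncomputable def slack (n t : ℕ) : ℝ := 1 / 4 * (1 / 3) ^ (2 ^ n - t)

theorem slack_pos (n t : ℕ) : 0 < slack n t := by unfold slack; positivity

theorem slack_le (n t : ℕ) : slack n t ≤ 1 / 4 := by
  have : (1 / 3 : ℝ) ^ (2 ^ n - t) ≤ 1 := pow_le_one₀ (by norm_num) (by norm_num)
  unfold slack; linarith

theorem three_mul_slack_le {n s t : ℕ} (h : s < t) (ht : t ≤ 2 ^ n) :
    3 * slack n s ≤ slack n t := by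
  have h1 : (1 / 3 : ℝ) ^ (2 ^ n - s) ≤ (1 / 3) ^ (2 ^ n - t + 1) :=
    pow_le_pow_of_le_one (by norm_num) (by norm_num) (by omega)
  rw [pow_succ] at h1
  unfold slack; linarith

/-- A shape with unit foot and spine `1 - slack n t`; in a unit window, shapes with larger `t`
are forced to the right of those with smaller `t`. -/
noncomputable def keyShape (n t : ℕ) : LShape where
  lx := 1
  ly := 1 - slack n t
  wx := 1 / (n + 1)
  wy := 2 * slack n t
  wx_pos := by positivity
  wy_pos := by have := slack_pos n t; linarith
  wx_le := by rw [div_le_one (by positivity)]; linarith [(Nat.cast_nonneg n : (0 : ℝ) ≤ n)]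
  wy_le := by have := slack_le n t; linarith
  lx_le_one := le_rfl
  ly_le_one := by have := slack_pos n t; linarith

theorem not_disjoint_of_point {A B : Set (ℝ × ℝ)} {a b c d a' b' c' d' : ℝ}
    (hA : Set.Ioo a b ×ˢ Set.Ioo c d ⊆ A) (hB : Set.Ioo a' b' ×ˢ Set.Ioo c' d' ⊆ B)
    (h1 : max a a' < min b b') (h2 : max c c' < min d d') : ¬ Disjoint A B := by
  obtain ⟨x, hx, hx'⟩ := exists_between h1
  obtain ⟨y, hy, hy'⟩ := exists_between h2
  rw [max_lt_iff] at hx hy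
  rw [lt_min_iff] at hx' hy'
  exact Set.not_disjoint_iff.2 ⟨(x, y), hA ⟨⟨hx.1, hx'.1⟩, ⟨hy.1, hy'.1⟩⟩,
    hB ⟨⟨hx.2, hx'.2⟩, ⟨hy.2, hy'.2⟩⟩⟩

/-- The strip leaves corners only the heights `[0, slack]`, so a shape `s` to the right of the spine
of `t` has a spine that reaches down into the thick foot of `t`. -/
theorem keyShape_order {n s t : ℕ} (hst : s < t) (ht : t ≤ 2 ^ n) {p q : ℝ × ℝ}
    (hp : (keyShape n s).region p ⊆ stripPack.container)
    (hq : (keyShape n t).region q ⊆ stripPack.container)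
    (hd : Disjoint (interior ((keyShape n s).region p)) (interior ((keyShape n t).region q)))
    (hpq : p.1 < q.1 + 1) : p.1 + 1 / (n + 1) ≤ q.1 := by
  have hs := slack_pos n s
  have h3 := three_mul_slack_le hst ht
  have ht4 := slack_le n t
  have hp2 : 0 ≤ p.2 := (hp ((keyShape n s).corner_mem_region p)).2.1
  have hq2 : 0 ≤ q.2 := (hq ((keyShape n t).corner_mem_region q)).2.1
  have hp3 : p.2 + (1 - slack n s) ≤ 1 := (hp ((keyShape n s).top_mem_region p)).2.2
  have hq3 : q.2 + (1 - slack n t) ≤ 1 := (hq ((keyShape n t).top_mem_region q)).2.2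
  have hn : (0 : ℝ) < 1 / (n + 1) := by positivity
  by_contra! hlt
  -- Either the spines overlap horizontally, and then also vertically, both being at least `3/4`
  -- tall in a strip of height 1. Or the spine of `s` stands over the foot of `t`; its bottom is at
  -- most `slack n s`, below the top of the foot, which is at least `2 * slack n t`.
  by_cases hov : p.1 < q.1 + 1 / (n + 1)
  · refine not_disjoint_of_point ((keyShape n s).spine_subset_interior p)
      ((keyShape n t).spine_subset_interior q) ?_ ?_ hd
    · simp only [keyShape, max_lt_iff, lt_min_iff]
      refine ⟨⟨?_, ?_⟩, ?_, ?_⟩ <;> linarith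
    · simp only [keyShape, max_lt_iff, lt_min_iff]
      refine ⟨⟨?_, ?_⟩, ?_, ?_⟩ <;> linarith
  · refine not_disjoint_of_point ((keyShape n s).spine_subset_interior p)
      ((keyShape n t).foot_subset_interior q) ?_ ?_ hd
    · simp only [keyShape, max_lt_iff, lt_min_iff]
      refine ⟨⟨?_, ?_⟩, ?_, ?_⟩ <;> linarith
    · simp only [keyShape, max_lt_iff, lt_min_iff]
      refine ⟨⟨?_, ?_⟩, ?_, ?_⟩ <;> linarith

theorem opt_stripPack_nonneg (σ : List LShape) : 0 ≤ stripPack.opt σ := by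
  refine Real.sInf_nonneg ?_
  rintro c ⟨P, hP, rfl⟩
  refine Real.sSup_nonneg ?_
  rintro x ⟨z, hz, rfl⟩
  obtain ⟨i, hi⟩ := Set.mem_iUnion.1 hz
  exact (hP.1 i hi).1

theorem opt_stripPack_le {σ : List LShape} {P : Fin σ.length → ℝ × ℝ} {c : ℝ} (hc : 0 ≤ c)
    (hP : IsPacking stripPack.container σ P) (h : ∀ i, (P i).1 + (σ.get i).lx ≤ c) :
    stripPack.opt σ ≤ c := by
  have hle : stripPack.cost (occupied σ P) ≤ c := by
    refine Real.sSup_le ?_ hc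
    rintro x ⟨z, hz, rfl⟩
    obtain ⟨i, hi⟩ := Set.mem_iUnion.1 hz
    exact ((σ.get i).region_subset_box _ hi).1.2.trans (h i)
  have hb : BddBelow {c | ∃ P, IsPacking stripPack.container σ P ∧
      c = stripPack.cost (occupied σ P)} := by
    refine ⟨0, ?_⟩
    rintro c ⟨P, hP, rfl⟩
    refine Real.sSup_nonneg ?_
    rintro x ⟨z, hz, rfl⟩
    obtain ⟨i, hi⟩ := Set.mem_iUnion.1 hz
    exact (hP.1 i hi).1
  exact (csInf_le hb ⟨P, hP, rfl⟩).trans hle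

/-- The shape of rank `r` among the keys goes to abscissa `r/(n+1)`, as high as the strip allows.
The tripling of `slack` is what lets the next foot clear the previous one: `slack + 2 * slack` is at
most the next slack. -/
theorem opt_keyShape_le {n : ℕ} {ks : List ℕ} (hlen : ks.length ≤ n) (hnd : ks.Nodup)
    (hk : ∀ k ∈ ks, k ≤ 2 ^ n) : stripPack.opt (ks.map (keyShape n)) ≤ 2 := by
  let r : ℕ → ℕ := fun k => (ks.toFinset.filter (· < k)).card
  have hr : ∀ k, r k ≤ n := fun k =>
    (Finset.card_le_card (Finset.filter_subset _ _)).trans ((List.toFinset_card_le ks).trans hlen)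
  have hlt : ∀ k ∈ ks, ∀ l, k < l → r k + 1 ≤ r l := by
    intro k hk l hkl
    refine Finset.card_lt_card (Finset.ssubset_iff.2 ⟨k, by simp, ?_⟩)
    intro x hx
    rcases Finset.mem_insert.1 hx with rfl | hx
    · simp [hk, hkl]
    · simp only [Finset.mem_filter] at hx ⊢
      exact ⟨hx.1, hx.2.trans hkl⟩
  let pos : ℕ → ℝ × ℝ := fun k => (r k / (n + 1), slack n k)
  have hn : (0 : ℝ) < n + 1 := by positivity
  have hr1 : ∀ k, (r k : ℝ) / (n + 1) ≤ 1 := fun k => by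
    rw [div_le_one hn]
    have : (r k : ℝ) ≤ n := by exact_mod_cast hr k
    linarith
  have hprec : ∀ k ∈ ks, ∀ l ∈ ks, k < l →
      Precedes (profile (keyShape n k)) (pos k) (pos l) := by
    intro k hk' l hl hkl
    right; right
    constructor
    · simp only [profile, keyShape, pos]
      rw [← add_div]
      gcongr
      exact_mod_cast hlt k hk' l hkl
    · simp only [profile, keyShape, pos]
      have := three_mul_slack_le hkl (hk l hl)
      linarith
  let P : Fin (ks.map (keyShape n)).length → ℝ × ℝ := fun i => pos (ks[i]'(by simpa using i.2))
  have hget : ∀ i : Fin (ks.map (keyShape n)).length,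
      (ks.map (keyShape n)).get i = keyShape n (ks[i]'(by simpa using i.2)) := by simp
  refine opt_stripPack_le (P := P) (by norm_num) ⟨fun i => ?_, fun i j hij => ?_⟩ fun i => ?_
  · rw [hget]
    refine ((keyShape n _).region_subset_box _).trans ?_
    have := slack_pos n (ks[i]'(by simpa using i.2))
    refine Set.prod_mono (fun x hx => ?_) (fun y hy => ?_)
    · exact le_trans (by simp only [P, pos]; positivity) hx.1
    · refine ⟨le_trans (by simp only [P, pos]; exact this.le) hy.1, hy.2.trans ?_⟩
      simp [P, pos, keyShape]
  · have hi : (i : ℕ) < ks.length := by simpa using i.2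
    have hj : (j : ℕ) < ks.length := by simpa using j.2
    have hne : ks[(i : ℕ)] ≠ ks[(j : ℕ)] := by
      rw [Ne, hnd.getElem_inj_iff]
      exact fun h => hij (Fin.ext h)
    simp only [hget]
    rcases lt_or_gt_of_ne hne with h | h
    · exact (hprec _ (List.getElem_mem hi) _ (List.getElem_mem hj) h).disjoint_interior
    · exact (hprec _ (List.getElem_mem hj) _ (List.getElem_mem hi) h).disjoint_interior.symm
  · rw [hget]
    simp only [P, pos, keyShape]
    have := hr1 (ks[(i : ℕ)]'(by simpa using i.2))
    exact (add_le_add_left this 1).trans (by norm_num)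

/-- The abscissa at which `𝒜` places the `j`-th of the shapes with keys `ks`. -/
noncomputable def keyAbscissa (𝒜 : OnlineAlgorithm) (n : ℕ) (ks : List ℕ) (j : ℕ) : ℝ :=
  (𝒜 ((ks.take (j + 1)).map (keyShape n))).1

theorem keyAbscissa_append {𝒜 : OnlineAlgorithm} {n : ℕ} {ks : List ℕ} {j : ℕ}
    (hj : j < ks.length) (l : List ℕ) :
    keyAbscissa 𝒜 n (ks ++ l) j = keyAbscissa 𝒜 n ks j := by
  unfold keyAbscissa
  rw [List.take_append_of_le_length (by omega)]

theorem run_map_keyShape (𝒜 : OnlineAlgorithm) (n : ℕ) (ks : List ℕ)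
    (i : Fin (ks.map (keyShape n)).length) :
    (𝒜.run (ks.map (keyShape n)) i).1 = keyAbscissa 𝒜 n ks i := by
  simp [OnlineAlgorithm.run, keyAbscissa, List.map_take]

theorem keyAbscissa_order {𝒜 : OnlineAlgorithm} (h𝒜 : stripPack.Solves 𝒜) {n : ℕ} {ks : List ℕ}
    {i j : ℕ} (hi : i < ks.length) (hj : j < ks.length) (hij : ks[i] < ks[j])
    (hk : ks[j] ≤ 2 ^ n) (hx : keyAbscissa 𝒜 n ks i < keyAbscissa 𝒜 n ks j + 1) :
    keyAbscissa 𝒜 n ks i + 1 / (n + 1) ≤ keyAbscissa 𝒜 n ks j := by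
  have h := h𝒜 (ks.map (keyShape n))
  let a : Fin (ks.map (keyShape n)).length := ⟨i, by simpa using hi⟩
  let b : Fin (ks.map (keyShape n)).length := ⟨j, by simpa using hj⟩
  have hab : a ≠ b := by
    intro hab
    have : i = j := congrArg Fin.val hab
    subst this
    exact lt_irrefl _ hij
  have h1 := h.1 a
  have h2 := h.1 b
  have h3 := h.2 hab
  have ha : (ks.map (keyShape n)).get a = keyShape n ks[i] := by simp [a]
  have hb : (ks.map (keyShape n)).get b = keyShape n ks[j] := by simp [b]
  dsimp only at h3
  rw [ha] at h1 h3
  rw [hb] at h2 h3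
  have := keyShape_order hij hk h1 h2 h3
  rw [run_map_keyShape, run_map_keyShape] at this
  exact this hx

theorem keyAbscissa_nonneg {𝒜 : OnlineAlgorithm} (h𝒜 : stripPack.Solves 𝒜) {n : ℕ}
    {ks : List ℕ} {i : ℕ} (hi : i < ks.length) : 0 ≤ keyAbscissa 𝒜 n ks i := by
  have h := (h𝒜 (ks.map (keyShape n))).1 ⟨i, by simpa using hi⟩
    (LShape.corner_mem_region _ _)
  rw [← run_map_keyShape 𝒜 n ks ⟨i, by simpa using hi⟩]
  exact h.1

theorem keyAbscissa_le_cost {𝒜 : OnlineAlgorithm} {n : ℕ}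
    {ks : List ℕ} {i : ℕ} (hi : i < ks.length) :
    keyAbscissa 𝒜 n ks i ≤ stripPack.algCost 𝒜 (ks.map (keyShape n)) := by
  rw [← run_map_keyShape 𝒜 n ks ⟨i, by simpa using hi⟩]
  refine le_csSup ?_ ⟨_, Set.mem_iUnion.2 ⟨_, LShape.corner_mem_region _ _⟩, rfl⟩
  refine ⟨∑ j, (|(𝒜.run (ks.map (keyShape n)) j).1| + 1), ?_⟩
  rintro x ⟨z, hz, rfl⟩
  obtain ⟨j, hj⟩ := Set.mem_iUnion.1 hz
  have h1 := (LShape.region_subset_box _ _ hj).1.2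
  have h2 := ((ks.map (keyShape n)).get j).lx_le_one
  have h3 := Finset.single_le_sum (f := fun j => |(𝒜.run (ks.map (keyShape n)) j).1| + 1)
    (fun j _ => by positivity) (Finset.mem_univ j)
  have h4 := le_abs_self (𝒜.run (ks.map (keyShape n)) j).1
  linarith

/-- The number of the shapes with keys `ks` whose corners `𝒜` places in `[m, m + 1) × ℝ`. -/
noncomputable def cellCount (𝒜 : OnlineAlgorithm) (n : ℕ) (ks : List ℕ) (m : ℕ) : ℕ :=
  ((Finset.range ks.length).filter fun j => ⌊keyAbscissa 𝒜 n ks j⌋₊ = m).card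

theorem cellCount_append (𝒜 : OnlineAlgorithm) (n : ℕ) (ks : List ℕ) (k m : ℕ) :
    cellCount 𝒜 n (ks ++ [k]) m = cellCount 𝒜 n ks m +
      if ⌊keyAbscissa 𝒜 n (ks ++ [k]) ks.length⌋₊ = m then 1 else 0 := by
  unfold cellCount
  have : (ks ++ [k]).length = ks.length + 1 := by simp
  rw [this, Finset.range_add_one, Finset.filter_insert]
  have hc : (Finset.range ks.length).filter (fun j => ⌊keyAbscissa 𝒜 n (ks ++ [k]) j⌋₊ = m) =
      (Finset.range ks.length).filter (fun j => ⌊keyAbscissa 𝒜 n ks j⌋₊ = m) := by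
    refine Finset.filter_congr fun j hj => ?_
    rw [keyAbscissa_append (Finset.mem_range.1 hj)]
  rw [hc]
  split_ifs with h
  · rw [Finset.card_insert_of_notMem (by simp)]
  · rfl

/-- The invariant of the adversary: all future keys lie strictly between `lo` and
`lo + 2 ^ (n - ks.length)`, and force future shapes in cell `m` into `[l m, r m]`. -/
structure Adversary (𝒜 : OnlineAlgorithm) (n : ℕ) (ks : List ℕ) (lo : ℕ) (l r : ℕ → ℝ) :
    Prop where
  nodup : ks.Nodup
  le : ∀ k ∈ ks, k ≤ 2 ^ n
  hi_le : lo + 2 ^ (n - ks.length) ≤ 2 ^ n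
  outside : ∀ k ∈ ks, k ≤ lo ∨ lo + 2 ^ (n - ks.length) ≤ k
  gap : ∀ m, r m - l m ≤ (1 / 2) ^ cellCount 𝒜 n ks m
  low : ∀ j (hj : j < ks.length), ks[j] ≤ lo →
    keyAbscissa 𝒜 n ks j ≤ l ⌊keyAbscissa 𝒜 n ks j⌋₊
  high : ∀ j (hj : j < ks.length), lo + 2 ^ (n - ks.length) ≤ ks[j] →
    r ⌊keyAbscissa 𝒜 n ks j⌋₊ ≤ keyAbscissa 𝒜 n ks j
  left : ∀ m : ℕ, l m = m ∨ ∃ j, ∃ hj : j < ks.length, ks[j] ≤ lo ∧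
    ⌊keyAbscissa 𝒜 n ks j⌋₊ = m ∧ keyAbscissa 𝒜 n ks j = l m
  right : ∀ m : ℕ, r m = m + 1 ∨ ∃ j, ∃ hj : j < ks.length, lo + 2 ^ (n - ks.length) ≤ ks[j] ∧
    ⌊keyAbscissa 𝒜 n ks j⌋₊ = m ∧ keyAbscissa 𝒜 n ks j = r m
  count : ∀ m, cellCount 𝒜 n ks m ≤ 1 + Nat.log 2 (n + 1)

theorem Adversary.nil (𝒜 : OnlineAlgorithm) (n : ℕ) :
    Adversary 𝒜 n [] 0 (fun m => m) (fun m => m + 1) where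
  nodup := List.nodup_nil
  le := by simp
  hi_le := by simp
  outside := by simp
  gap m := by simp [cellCount]
  low := by simp
  high := by simp
  left m := Or.inl rfl
  right m := Or.inl rfl
  count m := by simp [cellCount]

theorem lt_floor_add_one_of_floor_eq {x y : ℝ} (hy : 0 ≤ y) (h : ⌊x⌋₊ = ⌊y⌋₊) :
    x < y + 1 := by
  have h1 := Nat.lt_floor_add_one x
  have h2 := Nat.floor_le hy
  rw [h] at h1
  linarith

/-- One binary search serves all cells: only the cell that received the new shape has its interval
shortened, and shrinking the key range preserves the constraints of the others. -/
theorem Adversary.step {𝒜 : OnlineAlgorithm} (h𝒜 : stripPack.Solves 𝒜) {n : ℕ} {ks : List ℕ}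
    {lo : ℕ} {l r : ℕ → ℝ} (h : Adversary 𝒜 n ks lo l r) (hlen : ks.length < n) :
    ∃ k lo' l' r', Adversary 𝒜 n (ks ++ [k]) lo' l' r' := by
  obtain ⟨e, he⟩ : ∃ e, n - ks.length = e + 1 := ⟨n - ks.length - 1, by omega⟩
  have hn : n - (ks.length + 1) = e := by omega
  have hhi := h.hi_le
  have hout := h.outside
  have hpos : 0 < 2 ^ e := by positivity
  -- The next key is the midpoint of the current range.
  obtain ⟨k, hk⟩ : ∃ k, k = lo + 2 ^ e := ⟨_, rfl⟩
  obtain ⟨a, ha⟩ : ∃ a, a = keyAbscissa 𝒜 n (ks ++ [k]) ks.length := ⟨_, rfl⟩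
  obtain ⟨m, hm⟩ : ∃ m, m = ⌊a⌋₊ := ⟨_, rfl⟩
  have hlen' : (ks ++ [k]).length = ks.length + 1 := by simp
  have hold : ∀ j, j < ks.length → keyAbscissa 𝒜 n (ks ++ [k]) j = keyAbscissa 𝒜 n ks j :=
    fun j hj => keyAbscissa_append hj _
  have holdk : ∀ j (hj : j < ks.length), (ks ++ [k])[j]'(by omega) = ks[j] :=
    fun j hj => List.getElem_append_left hj
  have hnewk : (ks ++ [k])[ks.length]'(by omega) = k := by simp
  have ha0 : 0 ≤ a := ha ▸ keyAbscissa_nonneg h𝒜 (by omega)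
  have hw : (0 : ℝ) < 1 / (n + 1) := by positivity
  rw [he, pow_succ] at hhi hout
  have hexp : n - (ks ++ [k]).length = e := by omega
  have hkn : k ≤ 2 ^ n := by omega
  have hmem : ∀ j (hj : j < ks.length), ks[j] ∈ ks := fun j hj => List.getElem_mem hj
  have hlow : ∀ j (hj : j < ks.length), ks[j] ≤ lo → ⌊keyAbscissa 𝒜 n ks j⌋₊ = m →
      keyAbscissa 𝒜 n ks j + 1 / (n + 1) ≤ a := by
    intro j hj hjl hjm
    have := keyAbscissa_order h𝒜 (n := n) (ks := ks ++ [k]) (i := j) (j := ks.length)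
      (by omega) (by omega) (by rw [holdk j hj, hnewk]; omega) (by rw [hnewk]; exact hkn)
    rw [hold j hj, ← ha] at this
    exact this (lt_floor_add_one_of_floor_eq ha0 (hjm.trans hm))
  have hhigh : ∀ j (hj : j < ks.length), lo + 2 ^ e * 2 ≤ ks[j] →
      ⌊keyAbscissa 𝒜 n ks j⌋₊ = m → a + 1 / (n + 1) ≤ keyAbscissa 𝒜 n ks j := by
    intro j hj hjl hjm
    have := keyAbscissa_order h𝒜 (n := n) (ks := ks ++ [k]) (i := ks.length) (j := j)
      (by omega) (by omega) (by rw [holdk j hj, hnewk]; omega)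
      (by rw [holdk j hj]; exact h.le _ (hmem j hj))
    rw [hold j hj, ← ha] at this
    exact this (lt_floor_add_one_of_floor_eq (keyAbscissa_nonneg h𝒜 hj)
      (hm.symm.trans hjm.symm))
  have hma : (m : ℝ) ≤ a := hm ▸ Nat.floor_le ha0
  have ham : a < m + 1 := hm ▸ Nat.lt_floor_add_one a
  have hla : l m ≤ a := by
    rcases h.left m with hl | ⟨j, hj, hjl, hjm, hje⟩
    · rw [hl]; exact hma
    · have := hlow j hj hjl hjm; linarith
  have har : a ≤ r m := by
    rcases h.right m with hr | ⟨j, hj, hjl, hjm, hje⟩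
    · rw [hr]; exact ham.le
    · rw [he, pow_succ] at hjl
      have := hhigh j hj hjl hjm; linarith
  -- An earlier shape in the cell is a spine thickness away from `a` on one side, and the endpoint
  -- of the interval on that side is at least as far away.
  have hgap : cellCount 𝒜 n ks m ≠ 0 → 1 / ((n : ℝ) + 1) ≤ r m - l m := by
    intro hc
    obtain ⟨j, hj⟩ := Finset.card_ne_zero.1 hc
    simp only [Finset.mem_filter, Finset.mem_range] at hj
    obtain ⟨hj, hjm⟩ := hj
    rcases hout _ (hmem j hj) with hjl | hjl
    · have h1 := hlow j hj hjl hjm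
      suffices l m + 1 / (n + 1) ≤ a by linarith
      rcases h.left m with hl | ⟨i, hi, hil, him, hie⟩
      · have := h.low j hj hjl
        have := Nat.floor_le (keyAbscissa_nonneg h𝒜 (n := n) hj)
        rw [hjm] at this
        rw [hl]; linarith
      · rw [← hie]; exact hlow i hi hil him
    · have h1 := hhigh j hj hjl hjm
      suffices a + 1 / (n + 1) ≤ r m by linarith
      rcases h.right m with hr | ⟨i, hi, hil, him, hie⟩
      · have := Nat.lt_floor_add_one (keyAbscissa 𝒜 n ks j)
        rw [hjm] at this
        rw [hr]; linarith
      · rw [← hie]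
        rw [he, pow_succ] at hil
        exact hhigh i hi hil him
  have hcount : ∀ m, cellCount 𝒜 n (ks ++ [k]) m ≤ 1 + Nat.log 2 (n + 1) := by
    intro m'
    rw [cellCount_append, ← ha, ← hm]
    split_ifs with hmm
    · subst hmm
      -- The first corner in a cell costs nothing, whence the summand 1; each further one needs a
      -- gap of `1/(n+1)`.
      by_cases hc : cellCount 𝒜 n ks m = 0
      · omega
      · have h1 := (hgap hc).trans (h.gap m)
        rw [one_div_pow, one_div_le_one_div (by positivity) (by positivity)] at h1
        have h2 : 2 ^ cellCount 𝒜 n ks m ≤ n + 1 := by exact_mod_cast h1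
        have := Nat.le_log_of_pow_le (by norm_num) h2
        omega
    · exact h.count m'
  have hnodup : (ks ++ [k]).Nodup := by
    refine List.Nodup.append h.nodup (List.nodup_singleton k) ?_
    intro x hx hxk
    rw [List.mem_singleton] at hxk
    subst hxk
    rcases hout _ hx with h' | h' <;> omega
  have hle : ∀ x ∈ ks ++ [k], x ≤ 2 ^ n := by
    intro x hx
    rcases List.mem_append.1 hx with hx | hx
    · exact h.le x hx
    · rw [List.mem_singleton] at hx; rwa [hx]
  have hsplit : ∀ j (hj : j < (ks ++ [k]).length), (∃ hj' : j < ks.length,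
      (ks ++ [k])[j] = ks[j] ∧ keyAbscissa 𝒜 n (ks ++ [k]) j = keyAbscissa 𝒜 n ks j) ∨
      ((ks ++ [k])[j] = k ∧ keyAbscissa 𝒜 n (ks ++ [k]) j = a) := by
    intro j hj
    by_cases hj' : j < ks.length
    · exact Or.inl ⟨hj', holdk j hj', hold j hj'⟩
    · have : j = ks.length := by omega
      subst this
      exact Or.inr ⟨hnewk, ha.symm⟩
  have hcell : ∀ m', cellCount 𝒜 n (ks ++ [k]) m' =
      cellCount 𝒜 n ks m' + if m = m' then 1 else 0 := by
    intro m'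
    rw [cellCount_append, ← ha, ← hm]
  have hgap' := h.gap m
  -- If the left side is the shorter one, future keys stay below `k`, which forces future shapes of
  -- this cell to the left of `a`; otherwise they stay above.
  by_cases hside : a - l m ≤ r m - a
  · refine ⟨k, lo, l, Function.update r m a, hnodup, hle, ?_, ?_, ?_, ?_, ?_, ?_, ?_, hcount⟩
    · rw [hexp]; omega
    · rw [hexp]
      intro x hx
      rcases List.mem_append.1 hx with hx | hx
      · rcases hout x hx with h' | h' <;> omega
      · rw [List.mem_singleton] at hx; omega
    · intro m'
      rw [hcell]
      split_ifs with hmm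
      · subst hmm
        rw [Function.update_self, pow_succ]; linarith
      · rw [Function.update_of_ne (Ne.symm hmm)]; exact h.gap m'
    · intro j hj hjl
      rcases hsplit j hj with ⟨hj', e1, e2⟩ | ⟨e1, e2⟩
      · rw [e2]; exact h.low j hj' (e1 ▸ hjl)
      · rw [e1] at hjl; omega
    · intro j hj hjl
      rw [hexp] at hjl
      rcases hsplit j hj with ⟨hj', e1, e2⟩ | ⟨e1, e2⟩
      · rw [e2]
        rw [e1] at hjl
        have hjl' : lo + 2 ^ e * 2 ≤ ks[j] := by
          rcases hout _ (hmem j hj') with h' | h' <;> omega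
        by_cases hmm : ⌊keyAbscissa 𝒜 n ks j⌋₊ = m
        · rw [hmm, Function.update_self]
          linarith [hhigh j hj' hjl' hmm]
        · rw [Function.update_of_ne hmm]
          exact h.high j hj' (by rw [he, pow_succ]; exact hjl')
      · rw [e2, ← hm, Function.update_self]
    · intro m'
      rcases h.left m' with hl | ⟨j, hj, hjl, hjm, hje⟩
      · exact Or.inl hl
      · exact Or.inr ⟨j, by omega, by rw [holdk j hj]; exact hjl, by rw [hold j hj]; exact hjm,
          by rw [hold j hj]; exact hje⟩
    · intro m'
      rw [hexp]
      by_cases hmm : m' = m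
      · subst hmm
        refine Or.inr ⟨ks.length, by omega, by rw [hnewk, hk], by rw [← ha, hm], ?_⟩
        rw [Function.update_self, ha]
      · rw [Function.update_of_ne hmm]
        rcases h.right m' with hr | ⟨j, hj, hjl, hjm, hje⟩
        · exact Or.inl hr
        · rw [he, pow_succ] at hjl
          exact Or.inr ⟨j, by omega, by rw [holdk j hj]; omega, by rw [hold j hj]; exact hjm,
            by rw [hold j hj]; exact hje⟩
  · refine ⟨k, k, Function.update l m a, r, hnodup, hle, ?_, ?_, ?_, ?_, ?_, ?_, ?_, hcount⟩
    · rw [hexp]; omega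
    · rw [hexp]
      intro x hx
      rcases List.mem_append.1 hx with hx | hx
      · rcases hout x hx with h' | h' <;> omega
      · rw [List.mem_singleton] at hx; omega
    · intro m'
      rw [hcell]
      split_ifs with hmm
      · subst hmm
        rw [Function.update_self, pow_succ]; linarith
      · rw [Function.update_of_ne (Ne.symm hmm)]; exact h.gap m'
    · intro j hj hjl
      rcases hsplit j hj with ⟨hj', e1, e2⟩ | ⟨e1, e2⟩
      · rw [e2]
        rw [e1] at hjl
        have hjl' : ks[j] ≤ lo := by
          rcases hout _ (hmem j hj') with h' | h' <;> omega
        by_cases hmm : ⌊keyAbscissa 𝒜 n ks j⌋₊ = m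
        · rw [hmm, Function.update_self]
          linarith [hlow j hj' hjl' hmm]
        · rw [Function.update_of_ne hmm]
          exact h.low j hj' hjl'
      · rw [e2, ← hm, Function.update_self]
    · intro j hj hjl
      rw [hexp] at hjl
      rcases hsplit j hj with ⟨hj', e1, e2⟩ | ⟨e1, e2⟩
      · rw [e2]
        rw [e1] at hjl
        refine h.high j hj' ?_
        rw [he, pow_succ]; omega
      · rw [e1] at hjl; omega
    · intro m'
      by_cases hmm : m' = m
      · subst hmm
        refine Or.inr ⟨ks.length, by omega, by rw [hnewk], by rw [← ha, hm], ?_⟩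
        rw [Function.update_self, ha]
      · rw [Function.update_of_ne hmm]
        rcases h.left m' with hr | ⟨j, hj, hjl, hjm, hje⟩
        · exact Or.inl hr
        · exact Or.inr ⟨j, by omega, by rw [holdk j hj]; omega, by rw [hold j hj]; exact hjm,
            by rw [hold j hj]; exact hje⟩
    · intro m'
      rw [hexp]
      rcases h.right m' with hl | ⟨j, hj, hjl, hjm, hje⟩
      · exact Or.inl hl
      · rw [he, pow_succ] at hjl
        exact Or.inr ⟨j, by omega, by rw [holdk j hj]; omega, by rw [hold j hj]; exact hjm,
          by rw [hold j hj]; exact hje⟩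

theorem exists_adversary {𝒜 : OnlineAlgorithm} (h𝒜 : stripPack.Solves 𝒜) (n : ℕ) :
    ∀ i ≤ n, ∃ ks lo l r, ks.length = i ∧ Adversary 𝒜 n ks lo l r
  | 0, _ => ⟨[], _, _, _, rfl, Adversary.nil 𝒜 n⟩
  | i + 1, hi => by
    obtain ⟨ks, lo, l, r, hlen, h⟩ := exists_adversary h𝒜 n i (by omega)
    obtain ⟨k, lo', l', r', h'⟩ := h.step h𝒜 (by omega)
    exact ⟨_, lo', l', r', by simp [hlen], h'⟩

theorem exists_hard_sequence {𝒜 : OnlineAlgorithm} (h𝒜 : stripPack.Solves 𝒜) (n : ℕ) :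
    ∃ σ : List LShape, σ.length = n ∧ stripPack.opt σ ≤ 2 ∧
      (n : ℝ) ≤ (1 + Nat.log 2 (n + 1)) * (stripPack.algCost 𝒜 σ + 1) := by
  obtain ⟨ks, lo, l, r, hlen, h⟩ := exists_adversary h𝒜 n n le_rfl
  refine ⟨ks.map (keyShape n), by simp [hlen], opt_keyShape_le hlen.le h.nodup h.le, ?_⟩
  set c := stripPack.algCost 𝒜 (ks.map (keyShape n)) with hc
  have hx : ∀ j < ks.length, keyAbscissa 𝒜 n ks j ≤ c := fun j hj => keyAbscissa_le_cost hj
  have hc0 : 0 ≤ c := by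
    refine Real.sSup_nonneg ?_
    rintro x ⟨z, hz, rfl⟩
    obtain ⟨i, hi⟩ := Set.mem_iUnion.1 hz
    exact ((h𝒜 _).1 i hi).1
  have hcard : (Finset.range ks.length).card ≤
      (1 + Nat.log 2 (n + 1)) * (Finset.range (⌊c⌋₊ + 1)).card := by
    refine Finset.card_le_mul_card_image_of_maps_to
      (f := fun j => ⌊keyAbscissa 𝒜 n ks j⌋₊) (fun j hj => ?_) _ (fun m _ => h.count m)
    rw [Finset.mem_range] at *
    exact Nat.lt_succ_of_le (Nat.floor_le_floor (hx j hj))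
  rw [Finset.card_range, Finset.card_range, hlen] at hcard
  have h1 : (n : ℝ) ≤ (1 + Nat.log 2 (n + 1)) * (⌊c⌋₊ + 1) := by exact_mod_cast hcard
  refine h1.trans ?_
  gcongr
  exact Nat.floor_le hc0

theorem strip_lower_bound : ∃ c : ℝ, 0 < c ∧ ∀ 𝒜 : OnlineAlgorithm, stripPack.Solves 𝒜 →
    ∀ f : ℕ → ℝ, stripPack.HasAsymptoticCompetitiveRatio 𝒜 f →
      ∀ᶠ n : ℕ in Filter.atTop, c * (n / Real.log n) ≤ f n := by
  -- `20 = 5 * 2 * 2`: a factor 5 from comparing the binary with the natural logarithm, 2 for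
  -- absorbing `1 + β`, and 2 from the bound on the optimum.
  refine ⟨1 / 20, by norm_num, fun 𝒜 h𝒜 f ⟨β, hβ, hf⟩ => ?_⟩
  have hlim : Filter.Tendsto (fun n : ℕ => Real.log n / n) Filter.atTop (nhds 0) := by
    have := (Real.isLittleO_log_id_atTop.tendsto_div_nhds_zero).comp
      (tendsto_natCast_atTop_atTop (R := ℝ))
    exact this
  have hev := hlim.eventually_lt_const (show (0 : ℝ) < 1 / (10 * (1 + β)) by positivity)
  filter_upwards [hev, Filter.eventually_ge_atTop 3] with n hn hn3
  obtain ⟨σ, hlen, hopt, hcost⟩ := exists_hard_sequence h𝒜 n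
  have hσ := hf σ
  rw [hlen] at hσ
  have hn3' : (3 : ℝ) ≤ n := by exact_mod_cast hn3
  have hlog : 1 ≤ Real.log n := by
    rw [Real.le_log_iff_exp_le (by linarith)]
    linarith [Real.exp_one_lt_d9]
  have hnatlog : (Nat.log 2 (n + 1) : ℝ) ≤ 4 * Real.log n := by
    have h1 : (2 : ℝ) ^ Nat.log 2 (n + 1) ≤ n + 1 := by
      exact_mod_cast Nat.pow_log_le_self 2 (by omega)
    have h2 := Real.log_le_log (by positivity) (h1.trans (by nlinarith : (n : ℝ) + 1 ≤ n ^ 2))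
    rw [Real.log_pow, Real.log_pow] at h2
    have h3 := Real.log_two_gt_d9
    have h4 : (Nat.log 2 (n + 1) : ℝ) * (1 / 2) ≤ Nat.log 2 (n + 1) * Real.log 2 := by
      gcongr; linarith
    push_cast at h2
    linarith
  have hA : 0 ≤ stripPack.algCost 𝒜 σ + 1 := by
    by_contra! hneg
    have : (1 + (Nat.log 2 (n + 1) : ℝ)) * (stripPack.algCost 𝒜 σ + 1) < 0 :=
      mul_neg_of_pos_of_neg (by positivity) hneg
    linarith
  have h5 : (n : ℝ) ≤ 5 * Real.log n * (stripPack.algCost 𝒜 σ + 1) :=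
    hcost.trans (mul_le_mul_of_nonneg_right (by linarith) hA)
  have h6 : (n : ℝ) / Real.log n ≤ 5 * (stripPack.algCost 𝒜 σ + 1) := by
    rw [div_le_iff₀ (by linarith)]; linarith
  have h7 : 10 * (1 + β) < n / Real.log n := by
    rw [lt_div_iff₀ (by linarith)]
    rw [div_lt_div_iff₀ (by linarith) (by positivity)] at hn
    linarith
  have h8 : (n : ℝ) / Real.log n / 10 ≤ f n * stripPack.opt σ := by linarith
  -- The sign of `f n` is needed before the optimum may be replaced by its upper bound 2.
  have h9 : 0 ≤ f n := by
    by_contra! hneg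
    have := mul_nonpos_of_nonpos_of_nonneg hneg.le (opt_stripPack_nonneg σ)
    have : 0 < (n : ℝ) / Real.log n := div_pos (by linarith) (by linarith)
    linarith
  have h10 := mul_le_mul_of_nonneg_left hopt h9
  linarith

end LPacking

/-! ### Causality, bins and dyadic size classes -/

namespace LPacking

section Causal

variable {α β γ δ : Type*}

theorem Causal.comp {F : (ℕ → α) → ℕ → β} (hF : Causal F) (g : β → γ) :
    Causal fun s i => g (F s i) :=
  fun s s' i h => by simp only [hF s s' i h]

theorem Causal.comp₂ {F : (ℕ → α) → ℕ → β} {G : (ℕ → α) → ℕ → γ} (hF : Causal F)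
    (hG : Causal G) (g : β → γ → δ) : Causal fun s i => g (F s i) (G s i) :=
  fun s s' i h => by simp only [hF s s' i h, hG s s' i h]

theorem causal_eval : Causal fun (s : ℕ → α) i => s i := fun _ _ _ h => h _ le_rfl

theorem causal_index : Causal fun (_ : ℕ → α) i => i := fun _ _ _ _ => rfl

theorem Causal.reindex {F : (ℕ → α) → ℕ → β} (hF : Causal F) {o : (ℕ → α) → ℕ → ℕ}
    (ho : Causal o) (hle : ∀ s i, o s i ≤ i) : Causal fun s i => F s (o s i) := by
  intro s s' i h
  simp only [ho s s' i h]
  exact hF s s' _ fun j hj => h j (hj.trans (hle s' i))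

theorem Causal.sum_range {v : (ℕ → α) → ℕ → ℝ} (hv : Causal v) :
    Causal fun s i => ∑ j ∈ Finset.range i, v s j := fun s s' _ h =>
  Finset.sum_congr rfl fun j hj =>
    hv s s' j fun k hk => h k (hk.trans (Finset.mem_range.1 hj).le)

theorem Causal.precomp {F : (ℕ → β) → ℕ → γ} (hF : Causal F) {G : (ℕ → α) → ℕ → β}
    (hG : Causal G) : Causal fun s => F (G s) :=
  fun s s' i h => hF _ _ i fun j hj => hG s s' j fun k hk => h k (hk.trans hj)

end Causal

section Bins

variable {K : Type*} [DecidableEq K]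

/-- The sum of `v` over the indices before `i` that have the same key as `i`. -/
def keySum (κ : ℕ → K) (v : ℕ → ℝ) (i : ℕ) : ℝ :=
  ∑ j ∈ (Finset.range i).filter fun j => κ j = κ i, v j

/-- The first index with the same key as `i`. -/
def firstIdx (κ : ℕ → K) (i : ℕ) : ℕ := Nat.find (⟨i, rfl⟩ : ∃ j, κ j = κ i)

theorem key_firstIdx (κ : ℕ → K) (i : ℕ) : κ (firstIdx κ i) = κ i :=
  Nat.find_spec (⟨i, rfl⟩ : ∃ j, κ j = κ i)

theorem firstIdx_le (κ : ℕ → K) (i : ℕ) : firstIdx κ i ≤ i :=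
  Nat.find_min' (⟨i, rfl⟩ : ∃ j, κ j = κ i) rfl

theorem firstIdx_le_of_eq {κ : ℕ → K} {i j : ℕ} (h : κ j = κ i) : firstIdx κ i ≤ j :=
  Nat.find_min' (⟨i, rfl⟩ : ∃ j, κ j = κ i) h

theorem firstIdx_eq_iff {κ : ℕ → K} {i j : ℕ} : firstIdx κ i = firstIdx κ j ↔ κ i = κ j := by
  refine ⟨fun h => by rw [← key_firstIdx κ i, h, key_firstIdx κ j], fun h => le_antisymm ?_ ?_⟩
  · exact firstIdx_le_of_eq ((key_firstIdx κ j).trans h.symm)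
  · exact firstIdx_le_of_eq ((key_firstIdx κ i).trans h)

theorem firstIdx_firstIdx (κ : ℕ → K) (i : ℕ) : firstIdx κ (firstIdx κ i) = firstIdx κ i :=
  firstIdx_eq_iff.2 (key_firstIdx κ i)

theorem Causal.keySum {α : Type*} {κ : (ℕ → α) → ℕ → K} {v : (ℕ → α) → ℕ → ℝ} (hκ : Causal κ)
    (hv : Causal v) : Causal fun s => keySum (κ s) (v s) := by
  intro s s' i h
  have hlt : ∀ j ∈ Finset.range i, ∀ k ≤ j, s k = s' k := fun j hj k hk =>
    h k (hk.trans (Finset.mem_range.1 hj).le)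
  refine Finset.sum_congr (Finset.filter_congr fun j hj => ?_) fun j hj => ?_
  · rw [hκ s s' i h, hκ s s' j (hlt j hj)]
  · exact hv s s' j (hlt j (Finset.mem_filter.1 hj).1)

theorem Causal.firstIdx {α : Type*} {κ : (ℕ → α) → ℕ → K} (hκ : Causal κ) :
    Causal fun s => firstIdx (κ s) := by
  intro s s' i h
  have hlt : ∀ j ≤ i, κ s j = κ s' j := fun j hj => hκ s s' j fun k hk => h k (hk.trans hj)
  refine le_antisymm (firstIdx_le_of_eq ?_) (firstIdx_le_of_eq ?_)
  · rw [hlt _ (firstIdx_le _ _), key_firstIdx (κ s'), hlt i le_rfl]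
  · rw [← hlt _ (firstIdx_le _ _), key_firstIdx (κ s), hlt i le_rfl]

theorem keySum_nonneg {κ : ℕ → K} {v : ℕ → ℝ} {i : ℕ} (hv : ∀ j < i, 0 ≤ v j) :
    0 ≤ keySum κ v i :=
  Finset.sum_nonneg fun j hj => hv j (Finset.mem_range.1 (Finset.mem_filter.1 hj).1)

theorem keySum_add_le {κ : ℕ → K} {v : ℕ → ℝ} {i j : ℕ} (hij : i < j) (hκ : κ i = κ j)
    (hv : ∀ k < j, 0 ≤ v k) : keySum κ v i + v i ≤ keySum κ v j := by
  unfold keySum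
  rw [add_comm, ← Finset.sum_insert (by simp)]
  refine Finset.sum_le_sum_of_subset_of_nonneg (fun k hk => ?_) fun k hk _ =>
    hv k (Finset.mem_range.1 (Finset.mem_filter.1 hk).1)
  rcases Finset.mem_insert.1 hk with rfl | hk
  · simp [hij, hκ]
  · simp only [Finset.mem_filter, Finset.mem_range] at hk ⊢
    exact ⟨hk.1.trans hij, hk.2.trans hκ⟩

theorem keySum_le {κ : ℕ → K} {v : ℕ → ℝ} {i N : ℕ} (hi : i < N) (hv : ∀ k < N, 0 ≤ v k) :
    keySum κ v i ≤ ∑ j ∈ (Finset.range N).filter fun j => κ j = κ i, v j := by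
  refine Finset.sum_le_sum_of_subset_of_nonneg (fun k hk => ?_) fun k hk _ =>
    hv k (Finset.mem_range.1 (Finset.mem_filter.1 hk).1)
  simp only [Finset.mem_filter, Finset.mem_range] at hk ⊢
  exact ⟨hk.1.trans hi, hk.2⟩

/-- Items with key `k` are put into bins `(k, ⌊P⌋)`, where `P` is at most the total load of the
key.  Apart from one bin per key, opening the bins is paid for by the load. -/
theorem sum_openers_le {κ : ℕ → K} {P v : ℕ → ℝ} {g : K → ℝ} {N : ℕ} (hg : ∀ k, 0 ≤ g k)
    (hv : ∀ k < N, 0 ≤ v k)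
    (hP : ∀ i < N, P i ≤ ∑ j ∈ (Finset.range N).filter fun j => κ j = κ i, v j) :
    ∑ j ∈ Finset.range N, (if firstIdx (fun j => (κ j, ⌊P j⌋₊)) j = j then g (κ j) else 0) ≤
      ∑ k ∈ (Finset.range N).image κ, g k + ∑ j ∈ Finset.range N, g (κ j) * v j := by
  have hmaps : ∀ j ∈ Finset.range N, κ j ∈ (Finset.range N).image κ :=
    fun j hj => Finset.mem_image_of_mem κ hj
  rw [← Finset.sum_fiberwise_of_maps_to hmaps, ← Finset.sum_fiberwise_of_maps_to hmaps
    (fun j => g (κ j) * v j), ← Finset.sum_add_distrib]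
  refine Finset.sum_le_sum fun k _ => ?_
  set t := ∑ j ∈ (Finset.range N).filter fun j => κ j = k, v j with ht
  have ht0 : 0 ≤ t := Finset.sum_nonneg fun j hj =>
    hv j (Finset.mem_range.1 (Finset.mem_filter.1 hj).1)
  have h1 : ∑ j ∈ (Finset.range N).filter fun j => κ j = k, g (κ j) * v j = g k * t := by
    rw [ht, Finset.mul_sum]
    exact Finset.sum_congr rfl fun j hj => by rw [(Finset.mem_filter.1 hj).2]
  rw [h1, ← Finset.sum_filter]
  set O := ((Finset.range N).filter fun j => κ j = k).filter
    fun j => firstIdx (fun j => (κ j, ⌊P j⌋₊)) j = j with hO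
  have hmem : ∀ j ∈ O, j < N ∧ κ j = k ∧ firstIdx (fun j => (κ j, ⌊P j⌋₊)) j = j := by
    intro j hj
    simp only [hO, Finset.mem_filter, Finset.mem_range] at hj
    exact ⟨hj.1.1, hj.1.2, hj.2⟩
  have h2 : ∑ j ∈ O, g (κ j) = O.card * g k := by
    rw [Finset.sum_congr rfl fun j hj => by rw [(hmem j hj).2.1], Finset.sum_const, nsmul_eq_mul]
  -- Distinct openers with the same key have distinct floors of `P`, and these are at most `⌊t⌋₊`.
  have h3 : O.card ≤ ⌊t⌋₊ + 1 := by
    rw [← Finset.card_range (⌊t⌋₊ + 1)]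
    refine Finset.card_le_card_of_injOn (fun j => ⌊P j⌋₊) (fun j hj => ?_) fun i hi j hj hij => ?_
    · obtain ⟨hj, hjk, -⟩ := hmem j hj
      have := hP j hj
      rw [hjk] at this
      simp only [Finset.coe_range, Set.mem_Iio]
      exact Nat.lt_succ_of_le (Nat.floor_le_floor this)
    · obtain ⟨-, hik, hi⟩ := hmem i hi
      obtain ⟨-, hjk, hj⟩ := hmem j hj
      rw [← hi, ← hj, firstIdx_eq_iff]
      exact Prod.ext (hik.trans hjk.symm) hij
  have h4 : (O.card : ℝ) ≤ t + 1 := by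
    have : (O.card : ℝ) ≤ ⌊t⌋₊ + 1 := by exact_mod_cast h3
    linarith [Nat.floor_le ht0]
  rw [h2]
  have := mul_le_mul_of_nonneg_right h4 (hg k)
  linarith

end Bins

theorem sum_half_pow_le (S : Finset ℕ) : ∑ b ∈ S, (1 / 2 : ℝ) ^ b ≤ 2 := by
  exact (summable_geometric_two.sum_le_tsum S fun _ _ => by positivity).trans_eq
    tsum_geometric_two

theorem sum_half_pow_prod_le (S : Finset (ℕ × ℕ)) :
    ∑ k ∈ S, (1 / 2 : ℝ) ^ k.1 * (1 / 2) ^ k.2 ≤ 4 := by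
  calc ∑ k ∈ S, (1 / 2 : ℝ) ^ k.1 * (1 / 2) ^ k.2
      ≤ ∑ k ∈ S.image Prod.fst ×ˢ S.image Prod.snd, (1 / 2 : ℝ) ^ k.1 * (1 / 2) ^ k.2 := by
        refine Finset.sum_le_sum_of_subset_of_nonneg Finset.subset_product fun _ _ _ => ?_
        positivity
    _ = (∑ a ∈ S.image Prod.fst, (1 / 2 : ℝ) ^ a) * ∑ b ∈ S.image Prod.snd, (1 / 2 : ℝ) ^ b := by
        rw [Finset.sum_product, Finset.sum_mul_sum]
    _ ≤ 2 * 2 := mul_le_mul (sum_half_pow_le _) (sum_half_pow_le _)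
        (Finset.sum_nonneg fun _ _ => by positivity) (by norm_num)
    _ = 4 := by norm_num

/-- The number `a` with `X / 2 ^ (a + 1) < l ≤ X / 2 ^ a`. -/
noncomputable def sizeClass (X l : ℝ) : ℕ := Nat.log 2 ⌊X / l⌋₊

theorem le_sizeClass {X l : ℝ} (hl : 0 < l) (hX : l ≤ X) : l ≤ X * (1 / 2) ^ sizeClass X l := by
  have h1 : 1 ≤ X / l := (one_le_div hl).2 hX
  have h2 : ⌊X / l⌋₊ ≠ 0 := (Nat.floor_pos.2 h1).ne'
  have h3 : ((2 ^ sizeClass X l : ℕ) : ℝ) ≤ X / l :=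
    (Nat.cast_le.2 (Nat.pow_log_le_self 2 h2)).trans (Nat.floor_le (by linarith))
  rw [le_div_iff₀ hl] at h3
  push_cast at h3
  rw [one_div, inv_pow, ← div_eq_mul_inv, le_div_iff₀ (by positivity)]
  linarith

theorem sizeClass_lt {X l : ℝ} (hl : 0 < l) : X * (1 / 2) ^ sizeClass X l < 2 * l := by
  have h3 : X / l < ((2 ^ (sizeClass X l + 1) : ℕ) : ℝ) := by
    refine (Nat.lt_floor_add_one _).trans_le ?_
    exact_mod_cast Nat.lt_pow_succ_log_self (by norm_num) ⌊X / l⌋₊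
  rw [div_lt_iff₀ hl] at h3
  push_cast at h3
  rw [pow_succ] at h3
  rw [one_div, inv_pow, ← div_eq_mul_inv, div_lt_iff₀ (by positivity)]
  linarith

/-! ### Nesting in boxes on shelves -/

namespace ShelfPack

variable (X Y η : ℝ)

/-- The dyadic classes of the arm lengths. -/
noncomputable def cls (s : ℕ → Profile) (i : ℕ) : ℕ × ℕ :=
  (sizeClass X (s i).lx, sizeClass Y (s i).ly)

/-- The fraction of the diagonal of a box that an object uses up. -/
noncomputable def load (s : ℕ → Profile) (i : ℕ) : ℝ :=
  (s i).wx / (η * (X * (1 / 2) ^ (cls X Y s i).1)) + (s i).wy / (Y * (1 / 2) ^ (cls X Y s i).2)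

/-- The total load of the earlier objects of the class. -/
noncomputable def fill (s : ℕ → Profile) : ℕ → ℝ := keySum (cls X Y s) (load X Y η s)

/-- The box into which an object is put; those of a box are nested along its diagonal. -/
noncomputable def box (s : ℕ → Profile) (i : ℕ) : (ℕ × ℕ) × ℕ :=
  (cls X Y s i, ⌊fill X Y η s i⌋₊)

/-- The first object in the box of an object. -/
noncomputable def boxOpener (s : ℕ → Profile) : ℕ → ℕ := firstIdx (box X Y η s)

/-- The width of a newly opened box, in units of `η * X`. -/
noncomputable def boxWidth (s : ℕ → Profile) (i : ℕ) : ℝ :=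
  if boxOpener X Y η s i = i then (1 + η) / η * (1 / 2) ^ (cls X Y s i).1 else 0

/-- The total width of the boxes opened before that of an object, for its class of heights. -/
noncomputable def shelfFill (s : ℕ → Profile) (i : ℕ) : ℝ :=
  keySum (fun j => (cls X Y s j).2) (boxWidth X Y η s) (boxOpener X Y η s i)

/-- The shelf on which the box of an object lies. -/
noncomputable def shelf (s : ℕ → Profile) (i : ℕ) : ℕ × ℕ :=
  ((cls X Y s i).2, ⌊shelfFill X Y η s i⌋₊)

/-- The first object on the shelf of an object. -/
noncomputable def shelfOpener (s : ℕ → Profile) : ℕ → ℕ := firstIdx (shelf X Y η s)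

/-- The height of a newly opened shelf, in units of `Y`. -/
noncomputable def shelfHeight (s : ℕ → Profile) (i : ℕ) : ℝ :=
  if shelfOpener X Y η s i = i then 2 * (1 / 2) ^ (cls X Y s i).2 else 0

/-- The ordinate of the shelf of an object, in units of `Y`. -/
noncomputable def shelfBase (s : ℕ → Profile) (i : ℕ) : ℝ :=
  ∑ j ∈ Finset.range (shelfOpener X Y η s i), shelfHeight X Y η s j

/-- The position of an object. -/
noncomputable def pos (s : ℕ → Profile) (i : ℕ) : ℝ × ℝ :=
  (X * (η * (shelfFill X Y η s i - ⌊shelfFill X Y η s i⌋₊) +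
      η * (fill X Y η s i - ⌊fill X Y η s i⌋₊) * (1 / 2) ^ (cls X Y s i).1),
    Y * (shelfBase X Y η s i +
      (fill X Y η s i - ⌊fill X Y η s i⌋₊) * (1 / 2) ^ (cls X Y s i).2))

theorem causal_cls : Causal (cls X Y) :=
  causal_eval.comp fun p : Profile => (sizeClass X p.lx, sizeClass Y p.ly)

theorem causal_load : Causal (load X Y η) :=
  causal_eval.comp₂ (causal_cls X Y) fun (p : Profile) c =>
    p.wx / (η * (X * (1 / 2) ^ c.1)) + p.wy / (Y * (1 / 2) ^ c.2)

theorem causal_fill : Causal (fill X Y η) := (causal_cls X Y).keySum (causal_load X Y η)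

theorem causal_box : Causal (box X Y η) :=
  (causal_cls X Y).comp₂ (causal_fill X Y η) fun c x => (c, ⌊x⌋₊)

theorem causal_boxOpener : Causal (boxOpener X Y η) := (causal_box X Y η).firstIdx

theorem causal_boxWidth : Causal (boxWidth X Y η) :=
  ((causal_boxOpener X Y η).comp₂ causal_index Prod.mk).comp₂ (causal_cls X Y)
    fun o c => if o.1 = o.2 then (1 + η) / η * (1 / 2) ^ c.1 else 0

theorem causal_shelfFill : Causal (shelfFill X Y η) :=
  (((causal_cls X Y).comp Prod.snd).keySum (causal_boxWidth X Y η)).reindex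
    (causal_boxOpener X Y η) fun _ _ => firstIdx_le _ _

theorem causal_shelf : Causal (shelf X Y η) :=
  (causal_cls X Y).comp₂ (causal_shelfFill X Y η) fun c x => (c.2, ⌊x⌋₊)

theorem causal_shelfOpener : Causal (shelfOpener X Y η) := (causal_shelf X Y η).firstIdx

theorem causal_shelfHeight : Causal (shelfHeight X Y η) :=
  ((causal_shelfOpener X Y η).comp₂ causal_index Prod.mk).comp₂ (causal_cls X Y)
    fun o c => if o.1 = o.2 then 2 * (1 / 2) ^ c.2 else 0

theorem causal_shelfBase : Causal (shelfBase X Y η) :=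
  (causal_shelfHeight X Y η).sum_range.reindex (causal_shelfOpener X Y η)
    fun _ _ => firstIdx_le _ _

theorem causal_pos : Causal (pos X Y η) :=
  ((causal_shelfFill X Y η).comp₂ (causal_fill X Y η) Prod.mk).comp₂
    ((causal_shelfBase X Y η).comp₂ (causal_cls X Y) Prod.mk) fun p q =>
      (X * (η * (p.1 - ⌊p.1⌋₊) + η * (p.2 - ⌊p.2⌋₊) * (1 / 2) ^ q.2.1),
        Y * (q.1 + (p.2 - ⌊p.2⌋₊) * (1 / 2) ^ q.2.2))

variable {X Y η} {s : ℕ → Profile} {N : ℕ}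

theorem load_nonneg (hX : 0 < X) (hY : 0 < Y) (hη : 0 < η) {i : ℕ} (hx : 0 ≤ (s i).wx)
    (hy : 0 ≤ (s i).wy) : 0 ≤ load X Y η s i := by
  unfold load; positivity

theorem boxWidth_nonneg (hη : 0 < η) (i : ℕ) : 0 ≤ boxWidth X Y η s i := by
  unfold boxWidth; split_ifs <;> positivity

theorem shelfHeight_nonneg (i : ℕ) : 0 ≤ shelfHeight X Y η s i := by
  unfold shelfHeight; split_ifs <;> positivity

theorem shelfFill_nonneg (hη : 0 < η) (i : ℕ) : 0 ≤ shelfFill X Y η s i :=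
  keySum_nonneg fun j _ => boxWidth_nonneg hη j

theorem shelfBase_nonneg (i : ℕ) : 0 ≤ shelfBase X Y η s i :=
  Finset.sum_nonneg fun j _ => shelfHeight_nonneg j

theorem cls_boxOpener (i : ℕ) : cls X Y s (boxOpener X Y η s i) = cls X Y s i :=
  congrArg Prod.fst (key_firstIdx (box X Y η s) i)

theorem cls_shelfOpener (i : ℕ) : (cls X Y s (shelfOpener X Y η s i)).2 = (cls X Y s i).2 :=
  congrArg Prod.fst (key_firstIdx (shelf X Y η s) i)

theorem shelfBase_add_le {i j : ℕ} (h : shelfOpener X Y η s i < shelfOpener X Y η s j) :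
    shelfBase X Y η s i + 2 * (1 / 2) ^ (cls X Y s i).2 ≤ shelfBase X Y η s j := by
  have h1 : shelfHeight X Y η s (shelfOpener X Y η s i) = 2 * (1 / 2) ^ (cls X Y s i).2 := by
    rw [shelfHeight, cls_shelfOpener]
    exact if_pos (firstIdx_firstIdx _ _)
  unfold shelfBase
  rw [← h1, ← Finset.sum_range_succ]
  exact Finset.sum_le_sum_of_subset_of_nonneg (Finset.range_subset_range.2 h)
    fun k _ _ => shelfHeight_nonneg k

theorem shelfFill_add_le (hη : 0 < η) {i j : ℕ}
    (h : boxOpener X Y η s i < boxOpener X Y η s j) (hc : (cls X Y s i).2 = (cls X Y s j).2) :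
    shelfFill X Y η s i + (1 + η) / η * (1 / 2) ^ (cls X Y s i).1 ≤ shelfFill X Y η s j := by
  have h1 : boxWidth X Y η s (boxOpener X Y η s i) =
      (1 + η) / η * (1 / 2) ^ (cls X Y s i).1 := by
    rw [boxWidth, cls_boxOpener]
    exact if_pos (firstIdx_firstIdx _ _)
  rw [← h1]
  exact keySum_add_le (κ := fun j => (cls X Y s j).2) h (by simp only [cls_boxOpener, hc])
    fun k _ => boxWidth_nonneg hη k

/-- Multiplying the load by the box dimensions pairs each thickness with the dyadic length of its
own arm, which exceeds the true length by less than a factor 2. So load is paid for by area. -/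
theorem half_pow_mul_load_le (hX : 0 < X) (hY : 0 < Y) (hη : 0 < η) (hη1 : η ≤ 1) {i : ℕ}
    (hlx : 0 < (s i).lx) (hly : 0 < (s i).ly) (hx : 0 ≤ (s i).wx) (hy : 0 ≤ (s i).wy) :
    (1 / 2) ^ (cls X Y s i).1 * (1 / 2) ^ (cls X Y s i).2 * load X Y η s i ≤
      2 / (η * X * Y) * ((s i).wx * (s i).ly + (s i).wy * (s i).lx) := by
  have h1 : X * (1 / 2) ^ (cls X Y s i).1 ≤ 2 * (s i).lx := (sizeClass_lt hlx).le
  have h2 : Y * (1 / 2) ^ (cls X Y s i).2 ≤ 2 * (s i).ly := (sizeClass_lt hly).le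
  unfold load
  generalize (cls X Y s i).1 = a at *
  generalize (cls X Y s i).2 = b at *
  have e : (1 / 2 : ℝ) ^ a * (1 / 2) ^ b * ((s i).wx / (η * (X * (1 / 2) ^ a)) +
      (s i).wy / (Y * (1 / 2) ^ b)) =
      1 / (η * X * Y) * ((s i).wx * (Y * (1 / 2) ^ b) + η * ((s i).wy * (X * (1 / 2) ^ a))) := by
    have : (1 / 2 : ℝ) ^ a ≠ 0 := by positivity
    have : (1 / 2 : ℝ) ^ b ≠ 0 := by positivity
    generalize (1 / 2 : ℝ) ^ a = A at *
    generalize (1 / 2 : ℝ) ^ b = B at *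
    field_simp
  rw [e]
  have h3 := mul_le_mul_of_nonneg_left h2 hx
  have h4 := mul_le_mul_of_nonneg_left h1 hy
  have h5 : η * ((s i).wy * (X * (1 / 2) ^ a)) ≤ 1 * ((s i).wy * (X * (1 / 2) ^ a)) :=
    mul_le_mul_of_nonneg_right hη1 (by positivity)
  calc 1 / (η * X * Y) * ((s i).wx * (Y * (1 / 2) ^ b) + η * ((s i).wy * (X * (1 / 2) ^ a)))
      ≤ 1 / (η * X * Y) * (2 * ((s i).wx * (s i).ly + (s i).wy * (s i).lx)) :=
        mul_le_mul_of_nonneg_left (by linarith) (by positivity)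
    _ = _ := by ring

/-- Objects with arm lengths at most `X` and `Y` and positive arm lengths. -/
def Fits (X Y : ℝ) (p : Profile) : Prop :=
  0 < p.lx ∧ p.lx ≤ X ∧ 0 < p.ly ∧ p.ly ≤ Y ∧ 0 ≤ p.wx ∧ 0 ≤ p.wy

/-- `sum_openers_le` is applied twice: shelf heights are charged to box widths, and these to loads.
The last shelves contribute at most 4, the last boxes `16/η` and the loads `16/η`, in total at most
`36/η`. -/
theorem sum_shelfHeight_le (hX : 0 < X) (hY : 0 < Y) (hη : 0 < η) (hη1 : η ≤ 1)
    (hs : ∀ j < N, Fits X Y (s j))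
    (hA : ∑ j ∈ Finset.range N, ((s j).wx * (s j).ly + (s j).wy * (s j).lx) ≤ 2 * (η * X * Y)) :
    ∑ j ∈ Finset.range N, shelfHeight X Y η s j ≤ 36 / η := by
  have hload : ∀ j < N, 0 ≤ load X Y η s j := fun j hj =>
    load_nonneg hX hY hη (hs j hj).2.2.2.2.1 (hs j hj).2.2.2.2.2
  have h1 := sum_openers_le (κ := fun j => (cls X Y s j).2) (P := shelfFill X Y η s)
    (v := boxWidth X Y η s) (g := fun b => 2 * (1 / 2) ^ b) (N := N) (fun b => by positivity)
    (fun k _ => boxWidth_nonneg hη k) (fun i hi => by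
      have := keySum_le (κ := fun j => (cls X Y s j).2) (v := boxWidth X Y η s)
        ((firstIdx_le (box X Y η s) i).trans_lt hi) (fun k _ => boxWidth_nonneg hη k)
      simp only [show (cls X Y s (firstIdx (box X Y η s) i)).2 = (cls X Y s i).2 from
        congrArg Prod.snd (cls_boxOpener i)] at this
      exact this)
  have h2 := sum_openers_le (κ := cls X Y s) (P := fill X Y η s) (v := load X Y η s)
    (g := fun k => 4 / η * ((1 / 2) ^ k.1 * (1 / 2) ^ k.2)) (N := N) (fun b => by positivity)
    hload (fun i hi => keySum_le hi hload)
  have h3 : ∀ j ∈ Finset.range N, 2 * (1 / 2) ^ (cls X Y s j).2 * boxWidth X Y η s j ≤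
      if firstIdx (fun j => (cls X Y s j, ⌊fill X Y η s j⌋₊)) j = j then
        4 / η * ((1 / 2) ^ (cls X Y s j).1 * (1 / 2) ^ (cls X Y s j).2) else 0 := by
    intro j _
    unfold boxWidth boxOpener
    change _ ≤ if firstIdx (box X Y η s) j = j then _ else _
    split_ifs
    · have : (1 + η) / η ≤ 2 / η := by gcongr; linarith
      have h := mul_le_mul_of_nonneg_right this
        (show 0 ≤ 2 * ((1 / 2 : ℝ) ^ (cls X Y s j).1 * (1 / 2) ^ (cls X Y s j).2) by positivity)
      have e : 2 / η * (2 * ((1 / 2 : ℝ) ^ (cls X Y s j).1 * (1 / 2) ^ (cls X Y s j).2)) =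
        4 / η * ((1 / 2) ^ (cls X Y s j).1 * (1 / 2) ^ (cls X Y s j).2) := by ring
      linarith
    · simp
  have h4 : ∑ j ∈ Finset.range N, 4 / η * ((1 / 2) ^ (cls X Y s j).1 *
      (1 / 2) ^ (cls X Y s j).2) * load X Y η s j ≤ 4 / η * 4 := by
    calc _ ≤ ∑ j ∈ Finset.range N, 4 / η * (2 / (η * X * Y) *
          ((s j).wx * (s j).ly + (s j).wy * (s j).lx)) := by
          refine Finset.sum_le_sum fun j hj => ?_
          obtain ⟨a1, -, a2, -, a3, a4⟩ := hs j (Finset.mem_range.1 hj)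
          rw [mul_assoc]
          exact mul_le_mul_of_nonneg_left (half_pow_mul_load_le hX hY hη hη1 a1 a2 a3 a4)
            (by positivity)
      _ = 4 / η * (2 / (η * X * Y) *
          ∑ j ∈ Finset.range N, ((s j).wx * (s j).ly + (s j).wy * (s j).lx)) := by
          rw [Finset.mul_sum, Finset.mul_sum]
      _ ≤ 4 / η * (2 / (η * X * Y) * (2 * (η * X * Y))) := by gcongr
      _ = 4 / η * 4 := by field_simp; norm_num
  have h5 := sum_half_pow_le ((Finset.range N).image fun j => (cls X Y s j).2)
  have h6 := mul_le_mul_of_nonneg_left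
    (sum_half_pow_prod_le ((Finset.range N).image (cls X Y s))) (show 0 ≤ 4 / η by positivity)
  rw [Finset.mul_sum] at h6
  rw [← Finset.mul_sum] at h1
  have h7 := Finset.sum_le_sum h3
  have h8 : (1 : ℝ) ≤ 1 / η := by rw [le_div_iff₀ hη]; linarith
  have h9 : (36 : ℝ) / η = 36 * (1 / η) := by ring
  have h10 : (4 : ℝ) / η = 4 * (1 / η) := by ring
  change ∑ j ∈ Finset.range N, shelfHeight X Y η s j ≤ _ at h1
  linarith

theorem fract_bounds {x : ℝ} (hx : 0 ≤ x) : 0 ≤ x - ⌊x⌋₊ ∧ x - ⌊x⌋₊ ≤ 1 :=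
  ⟨sub_nonneg.2 (Nat.floor_le hx), by linarith [Nat.lt_floor_add_one x]⟩

theorem fill_nonneg (hX : 0 < X) (hY : 0 < Y) (hη : 0 < η) (hs : ∀ j < N, Fits X Y (s j))
    {i : ℕ} (hi : i ≤ N) : 0 ≤ fill X Y η s i :=
  keySum_nonneg fun j hj => load_nonneg hX hY hη (hs j (by omega)).2.2.2.2.1
    (hs j (by omega)).2.2.2.2.2

/-- A box starts within the first `ηX` of its shelf and may overshoot it; nesting shifts the corner
by at most another `ηX`. A small `η` thus keeps the width near `X` at the expense of height. -/
theorem pos_bounds (hX : 0 < X) (hY : 0 < Y) (hη : 0 < η) (hη1 : η ≤ 1)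
    (hs : ∀ j < N, Fits X Y (s j))
    (hA : ∑ j ∈ Finset.range N, ((s j).wx * (s j).ly + (s j).wy * (s j).lx) ≤ 2 * (η * X * Y))
    {i : ℕ} (hi : i < N) :
    (0 ≤ (pos X Y η s i).1 ∧ (pos X Y η s i).1 + (s i).lx ≤ (1 + 2 * η) * X) ∧
      0 ≤ (pos X Y η s i).2 ∧ (pos X Y η s i).2 + (s i).ly ≤ 40 / η * Y := by
  obtain ⟨u0, u1⟩ := fract_bounds (fill_nonneg hX hY hη hs hi.le)
  obtain ⟨v0, v1⟩ := fract_bounds (shelfFill_nonneg (X := X) (Y := Y) (s := s) hη i)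
  have t0 := shelfBase_nonneg (X := X) (Y := Y) (η := η) (s := s) i
  have t1 : shelfBase X Y η s i ≤ 36 / η := by
    refine le_trans ?_ (sum_shelfHeight_le hX hY hη hη1 hs hA)
    refine Finset.sum_le_sum_of_subset_of_nonneg (Finset.range_subset_range.2 ?_)
      fun k _ _ => shelfHeight_nonneg k
    exact (firstIdx_le _ _).trans hi.le
  have ha : ∀ a : ℕ, (1 / 2 : ℝ) ^ a ≤ 1 := fun a => pow_le_one₀ (by norm_num) (by norm_num)
  obtain ⟨-, hlx, -, hly, -, -⟩ := hs i hi
  have h8 : (1 : ℝ) ≤ 1 / η := by rw [le_div_iff₀ hη]; linarith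
  have h9 : (36 : ℝ) / η = 36 * (1 / η) := by ring
  have h10 : (40 : ℝ) / η = 40 * (1 / η) := by ring
  unfold pos
  generalize fill X Y η s i - ⌊fill X Y η s i⌋₊ = u at *
  generalize shelfFill X Y η s i - ⌊shelfFill X Y η s i⌋₊ = v at *
  refine ⟨⟨by positivity, ?_⟩, by positivity, ?_⟩
  · have h1 : η * v ≤ η * 1 := by gcongr
    have h2 : η * u * (1 / 2) ^ (cls X Y s i).1 ≤ η * 1 * 1 := by gcongr; exact ha _
    have h3 := mul_le_mul_of_nonneg_left (add_le_add h1 h2) hX.le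
    simp only
    linarith
  · have h2 : u * (1 / 2) ^ (cls X Y s i).2 ≤ 1 * 1 := by gcongr; exact ha _
    have h3 := mul_le_mul_of_nonneg_left (add_le_add t1 h2) hY.le
    have h4 := mul_le_mul_of_nonneg_right (show 36 / η + 1 * 1 + 1 ≤ 40 / η by linarith) hY.le
    simp only
    linarith

theorem precedes_of_shelfOpener_lt (hX : 0 < X) (hY : 0 < Y) (hη : 0 < η)
    (hs : ∀ j < N, Fits X Y (s j)) {i j : ℕ} (hi : i < N) (hj : j < N)
    (h : shelfOpener X Y η s i < shelfOpener X Y η s j) :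
    Precedes (s i) (pos X Y η s i) (pos X Y η s j) := by
  right; left
  obtain ⟨u0, u1⟩ := fract_bounds (fill_nonneg hX hY hη hs hi.le)
  obtain ⟨w0, w1⟩ := fract_bounds (fill_nonneg hX hY hη hs hj.le)
  have h1 := shelfBase_add_le h
  have hly : (s i).ly ≤ Y * (1 / 2) ^ (cls X Y s i).2 :=
    le_sizeClass (hs i hi).2.2.1 (hs i hi).2.2.2.1
  unfold pos
  generalize fill X Y η s i - ⌊fill X Y η s i⌋₊ = u at *
  generalize fill X Y η s j - ⌊fill X Y η s j⌋₊ = w at *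
  simp only
  have h2 : u * (1 / 2) ^ (cls X Y s i).2 ≤ 1 * (1 / 2) ^ (cls X Y s i).2 := by gcongr
  have h3 : 0 ≤ w * (1 / 2) ^ (cls X Y s j).2 := by positivity
  have h4 := mul_le_mul_of_nonneg_left (show shelfBase X Y η s i +
    u * (1 / 2) ^ (cls X Y s i).2 + (1 / 2) ^ (cls X Y s i).2 ≤
      shelfBase X Y η s j + w * (1 / 2) ^ (cls X Y s j).2 by linarith) hY.le
  linarith

theorem precedes_of_boxOpener_lt (hX : 0 < X) (hY : 0 < Y) (hη : 0 < η)
    (hs : ∀ j < N, Fits X Y (s j)) {i j : ℕ} (hi : i < N) (hj : j < N)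
    (h : boxOpener X Y η s i < boxOpener X Y η s j) (hsh : shelf X Y η s i = shelf X Y η s j) :
    Precedes (s i) (pos X Y η s i) (pos X Y η s j) := by
  left
  obtain ⟨u0, u1⟩ := fract_bounds (fill_nonneg hX hY hη hs hi.le)
  obtain ⟨w0, w1⟩ := fract_bounds (fill_nonneg hX hY hη hs hj.le)
  have h1 := shelfFill_add_le hη h (congrArg Prod.fst hsh)
  have hfl : ⌊shelfFill X Y η s i⌋₊ = ⌊shelfFill X Y η s j⌋₊ := congrArg Prod.snd hsh
  have hlx : (s i).lx ≤ X * (1 / 2) ^ (cls X Y s i).1 :=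
    le_sizeClass (hs i hi).1 (hs i hi).2.1
  unfold pos
  rw [hfl]
  generalize fill X Y η s i - ⌊fill X Y η s i⌋₊ = u at *
  generalize fill X Y η s j - ⌊fill X Y η s j⌋₊ = w at *
  simp only
  have h2 : η * u * (1 / 2) ^ (cls X Y s i).1 ≤ η * 1 * (1 / 2) ^ (cls X Y s i).1 := by gcongr
  have h3 : 0 ≤ η * w * (1 / 2) ^ (cls X Y s j).1 := by positivity
  have h5 := mul_le_mul_of_nonneg_left h1 hη.le
  have e : η * (shelfFill X Y η s i + (1 + η) / η * (1 / 2) ^ (cls X Y s i).1) =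
      η * shelfFill X Y η s i + (1 + η) * (1 / 2) ^ (cls X Y s i).1 := by field_simp
  rw [e] at h5
  have h4 := mul_le_mul_of_nonneg_left (show η * (shelfFill X Y η s i -
    ⌊shelfFill X Y η s j⌋₊) + η * u * (1 / 2) ^ (cls X Y s i).1 + (1 / 2) ^ (cls X Y s i).1 ≤
      η * (shelfFill X Y η s j - ⌊shelfFill X Y η s j⌋₊) + η * w * (1 / 2) ^ (cls X Y s j).1
    by linarith) hX.le
  linarith

/-- Objects of one box share its base point and differ only in `fill`. Since the load is the sum of
the two relative thicknesses, the advance along the diagonal clears both arms at once. -/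
theorem precedes_of_box_eq (hX : 0 < X) (hY : 0 < Y) (hη : 0 < η)
    (hs : ∀ j < N, Fits X Y (s j)) {i j : ℕ} (hij : i < j) (hj : j < N)
    (hb : box X Y η s i = box X Y η s j) :
    Precedes (s i) (pos X Y η s i) (pos X Y η s j) := by
  right; right
  have hcls : cls X Y s i = cls X Y s j := congrArg Prod.fst hb
  have hfl : ⌊fill X Y η s i⌋₊ = ⌊fill X Y η s j⌋₊ := congrArg Prod.snd hb
  have hbo : boxOpener X Y η s i = boxOpener X Y η s j := firstIdx_eq_iff.2 hb
  have hsf : shelfFill X Y η s i = shelfFill X Y η s j := by unfold shelfFill; rw [hbo]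
  have hso : shelfOpener X Y η s i = shelfOpener X Y η s j :=
    firstIdx_eq_iff.2 (by unfold shelf; rw [hcls, hsf])
  have hsb : shelfBase X Y η s i = shelfBase X Y η s j := by unfold shelfBase; rw [hso]
  have h1 : fill X Y η s i + load X Y η s i ≤ fill X Y η s j :=
    keySum_add_le hij hcls fun k hk => load_nonneg hX hY hη (hs k (by omega)).2.2.2.2.1
      (hs k (by omega)).2.2.2.2.2
  obtain ⟨-, -, -, -, hwx, hwy⟩ := hs i (by omega)
  unfold load at h1
  unfold pos
  rw [hsb, hsf, hfl, ← hcls]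
  simp only
  generalize (cls X Y s i).1 = a at *
  generalize (cls X Y s i).2 = b at *
  have ha : 0 < η * (X * (1 / 2) ^ a) := by positivity
  have hb : 0 < Y * (1 / 2) ^ b := by positivity
  have hx : 0 ≤ (s i).wx / (η * (X * (1 / 2) ^ a)) := by positivity
  have hy : 0 ≤ (s i).wy / (Y * (1 / 2) ^ b) := by positivity
  constructor
  · have h2 : (s i).wx / (η * (X * (1 / 2) ^ a)) ≤ fill X Y η s j - fill X Y η s i := by linarith
    rw [div_le_iff₀ ha] at h2
    linarith
  · have h2 : (s i).wy / (Y * (1 / 2) ^ b) ≤ fill X Y η s j - fill X Y η s i := by linarith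
    rw [div_le_iff₀ hb] at h2
    linarith

/-- Both directions occur, as a later object may join an older box or shelf of its own class. -/
theorem pos_separated (hX : 0 < X) (hY : 0 < Y) (hη : 0 < η)
    (hs : ∀ j < N, Fits X Y (s j)) {i j : ℕ} (hij : i < j) (hj : j < N) :
    Precedes (s i) (pos X Y η s i) (pos X Y η s j) ∨
      Precedes (s j) (pos X Y η s j) (pos X Y η s i) := by
  rcases lt_trichotomy (shelfOpener X Y η s i) (shelfOpener X Y η s j) with h | h | h
  · exact Or.inl (precedes_of_shelfOpener_lt hX hY hη hs (by omega) hj h)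
  · have hsh : shelf X Y η s i = shelf X Y η s j := firstIdx_eq_iff.1 h
    rcases lt_trichotomy (boxOpener X Y η s i) (boxOpener X Y η s j) with h' | h' | h'
    · exact Or.inl (precedes_of_boxOpener_lt hX hY hη hs (by omega) hj h' hsh)
    · exact Or.inl (precedes_of_box_eq hX hY hη hs hij hj (firstIdx_eq_iff.1 h'))
    · exact Or.inr (precedes_of_boxOpener_lt hX hY hη hs hj (by omega) h' hsh.symm)
  · exact Or.inr (precedes_of_shelfOpener_lt hX hY hη hs hj (by omega) h)

end ShelfPack

end LPacking

/-! ### Lower bounds on the bounding box -/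

open MeasureTheory in
-- The open foot and the part of the open spine above it are disjoint, lie in the interior and have
-- the full area between them.
theorem LShape.area_le_volume (L : LShape) (p : ℝ × ℝ) :
    ENNReal.ofReal L.area ≤ volume (interior (L.region p)) := by
  have hsub : Set.Ioo p.1 (p.1 + L.lx) ×ˢ Set.Ioo p.2 (p.2 + L.wy) ∪
      Set.Ioo p.1 (p.1 + L.wx) ×ˢ Set.Ioo (p.2 + L.wy) (p.2 + L.ly) ⊆ interior (L.region p) := by
    refine Set.union_subset (L.foot_subset_interior p) (Set.Subset.trans ?_
      (L.spine_subset_interior p))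
    exact Set.prod_mono le_rfl (Set.Ioo_subset_Ioo_left (by linarith [L.wy_pos]))
  refine le_trans ?_ (measure_mono hsub)
  rw [measure_union ?_ (measurableSet_Ioo.prod measurableSet_Ioo), Measure.volume_eq_prod,
    Measure.prod_prod, Measure.prod_prod]
  · simp only [Real.volume_Ioo]
    rw [← ENNReal.ofReal_mul (by linarith [L.lx_pos]), ← ENNReal.ofReal_mul (by linarith [L.wx_pos]),
      ← ENNReal.ofReal_add]
    · refine ENNReal.ofReal_le_ofReal (le_of_eq ?_)
      unfold LShape.area; ring
    · have := mul_pos L.lx_pos L.wy_pos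
      linarith
    · have := mul_nonneg L.wx_pos.le (sub_nonneg.2 L.wy_le)
      linarith
  · rw [Set.disjoint_left]
    rintro x h1 h2
    exact lt_irrefl _ (h1.2.2.trans h2.2.1)

namespace LPacking

theorem isCompact_occupied (σ : List LShape) (P : Fin σ.length → ℝ × ℝ) :
    IsCompact (occupied σ P) :=
  isCompact_iUnion fun _ =>
    (isCompact_Icc.prod isCompact_Icc).union (isCompact_Icc.prod isCompact_Icc)

theorem occupied_subset_boundingBox (σ : List LShape) (P : Fin σ.length → ℝ × ℝ) :
    occupied σ P ⊆ Set.Icc (sInf (Prod.fst '' occupied σ P)) (sSup (Prod.fst '' occupied σ P)) ×ˢ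
      Set.Icc (sInf (Prod.snd '' occupied σ P)) (sSup (Prod.snd '' occupied σ P)) := by
  have h1 := (isCompact_occupied σ P).image continuous_fst
  have h2 := (isCompact_occupied σ P).image continuous_snd
  intro z hz
  exact ⟨⟨csInf_le h1.bddBelow ⟨z, hz, rfl⟩, le_csSup h1.bddAbove ⟨z, hz, rfl⟩⟩,
    csInf_le h2.bddBelow ⟨z, hz, rfl⟩, le_csSup h2.bddAbove ⟨z, hz, rfl⟩⟩

theorem lx_le_bbWidth (σ : List LShape) (P : Fin σ.length → ℝ × ℝ) (i : Fin σ.length) :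
    (σ.get i).lx ≤ bbWidth (occupied σ P) := by
  have h1 := occupied_subset_boundingBox σ P (Set.mem_iUnion.2 ⟨i, LShape.corner_mem_region _ _⟩)
  have h2 := occupied_subset_boundingBox σ P (Set.mem_iUnion.2 ⟨i, LShape.right_mem_region _ _⟩)
  have h3 := h1.1.1
  have h4 := h2.1.2
  unfold bbWidth
  simp only at h3 h4
  linarith

theorem ly_le_bbHeight (σ : List LShape) (P : Fin σ.length → ℝ × ℝ) (i : Fin σ.length) :
    (σ.get i).ly ≤ bbHeight (occupied σ P) := by
  have h1 := occupied_subset_boundingBox σ P (Set.mem_iUnion.2 ⟨i, LShape.corner_mem_region _ _⟩)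
  have h2 := occupied_subset_boundingBox σ P (Set.mem_iUnion.2 ⟨i, LShape.top_mem_region _ _⟩)
  have h3 := h1.2.1
  have h4 := h2.2.2
  unfold bbHeight
  simp only at h3 h4
  linarith

theorem bbWidth_nonneg (σ : List LShape) (P : Fin σ.length → ℝ × ℝ) :
    0 ≤ bbWidth (occupied σ P) := by
  unfold bbWidth
  rcases (occupied σ P).eq_empty_or_nonempty with h | ⟨z, hz⟩
  · simp [h]
  · have := occupied_subset_boundingBox σ P hz
    linarith [this.1.1, this.1.2]

theorem bbHeight_nonneg (σ : List LShape) (P : Fin σ.length → ℝ × ℝ) :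
    0 ≤ bbHeight (occupied σ P) := by
  unfold bbHeight
  rcases (occupied σ P).eq_empty_or_nonempty with h | ⟨z, hz⟩
  · simp [h]
  · have := occupied_subset_boundingBox σ P hz
    linarith [this.2.1, this.2.2]

open MeasureTheory in
theorem sum_area_le {C : Set (ℝ × ℝ)} {σ : List LShape} {P : Fin σ.length → ℝ × ℝ}
    (hP : IsPacking C σ P) :
    ∑ j ∈ Finset.range σ.length, (seq σ j).area ≤
      bbWidth (occupied σ P) * bbHeight (occupied σ P) := by
  have h1 : ∑ i, ENNReal.ofReal (σ.get i).area ≤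
      ∑ i, volume (interior ((σ.get i).region (P i))) :=
    Finset.sum_le_sum fun i _ => (σ.get i).area_le_volume (P i)
  have h2 : volume (⋃ i, interior ((σ.get i).region (P i))) =
      ∑ i, volume (interior ((σ.get i).region (P i))) := by
    rw [measure_iUnion hP.2 fun i => isOpen_interior.measurableSet, tsum_fintype]
  have h3 := measure_mono (μ := volume) ((Set.iUnion_mono fun i => interior_subset).trans
    (occupied_subset_boundingBox σ P) : (⋃ i, interior ((σ.get i).region (P i))) ⊆ _)
  rw [h2, Measure.volume_eq_prod, Measure.prod_prod, Real.volume_Icc, Real.volume_Icc] at h3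
  change _ ≤ ENNReal.ofReal (bbWidth (occupied σ P)) * ENNReal.ofReal (bbHeight (occupied σ P))
    at h3
  rw [← ENNReal.ofReal_mul (bbWidth_nonneg σ P)] at h3
  have h4 := h1.trans h3
  rw [← ENNReal.ofReal_sum_of_nonneg fun i _ => (σ.get i).area_pos.le] at h4
  rw [Finset.sum_range]
  simp_rw [seq_eq_get]
  exact (ENNReal.ofReal_le_ofReal_iff
    (mul_nonneg (bbWidth_nonneg σ P) (bbHeight_nonneg σ P))).1 h4

theorem bbWidth_le {S : Set (ℝ × ℝ)} {w h : ℝ} (hS : S ⊆ Set.Icc 0 w ×ˢ Set.Icc 0 h)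
    (hw : 0 ≤ w) : bbWidth S ≤ w := by
  have h1 : sSup (Prod.fst '' S) ≤ w := Real.sSup_le (by rintro x ⟨z, hz, rfl⟩; exact (hS hz).1.2) hw
  have h2 : 0 ≤ sInf (Prod.fst '' S) :=
    Real.sInf_nonneg (by rintro x ⟨z, hz, rfl⟩; exact (hS hz).1.1)
  unfold bbWidth; linarith

theorem bbHeight_le {S : Set (ℝ × ℝ)} {w h : ℝ} (hS : S ⊆ Set.Icc 0 w ×ˢ Set.Icc 0 h)
    (hh : 0 ≤ h) : bbHeight S ≤ h := by
  have h1 : sSup (Prod.snd '' S) ≤ h := Real.sSup_le (by rintro x ⟨z, hz, rfl⟩; exact (hS hz).2.2) hh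
  have h2 : 0 ≤ sInf (Prod.snd '' S) :=
    Real.sInf_nonneg (by rintro x ⟨z, hz, rfl⟩; exact (hS hz).2.1)
  unfold bbHeight; linarith

/-! ### Packing in the plane by doubling -/

namespace Doubling

/-- The least size that the `i`-th object imposes on a bounding box, given the earlier ones. -/
noncomputable def demand (s : ℕ → LShape) (i : ℕ) : ℝ :=
  max (max (s i).lx (s i).ly) √(∑ j ∈ Finset.range i, (s j).area + (s i).area)

/-- The running maximum of the demand. -/
noncomputable def size (s : ℕ → LShape) (i : ℕ) : ℝ :=
  (Finset.range (i + 1)).sup' ⟨0, by simp⟩ (demand s)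

/-- The phase of the algorithm, the exponent of the least power of two above the size. -/
noncomputable def phase (s : ℕ → LShape) (i : ℕ) : ℤ := Int.clog 2 (size s i)

/-- Each phase has its own region, in which all objects so far are packed virtually; an object
is put where the packing of the current phase has it. -/
noncomputable def place (s : ℕ → LShape) (i : ℕ) : ℝ × ℝ :=
  (40 * 2 ^ phase s i, 0) +
    ShelfPack.pos (2 ^ phase s i) (2 ^ phase s i) 1 (fun j => profile (s j)) i

theorem causal_demand : Causal demand :=
  (causal_eval.comp LShape.area).sum_range.comp₂ causal_eval
    fun x (L : LShape) => max (max L.lx L.ly) √(x + L.area)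

theorem causal_size : Causal size := fun s s' _ h =>
  Finset.sup'_congr _ rfl fun j hj => causal_demand s s' j fun k hk =>
    h k (hk.trans (Nat.lt_succ_iff.1 (Finset.mem_range.1 hj)))

theorem causal_phase : Causal phase := causal_size.comp (Int.clog 2)

/-- The scale itself depends on the sequence, so the phases have to be identified before the
causality of `ShelfPack.pos` at a fixed scale applies. -/
theorem causal_place : Causal place := by
  intro s s' i h
  unfold place
  rw [causal_phase s s' i h]
  exact congrArg _ ((ShelfPack.causal_pos _ _ 1).precomp (causal_eval.comp profile) s s' i h)

variable {s : ℕ → LShape}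

theorem demand_le_size {i j : ℕ} (h : j ≤ i) : demand s j ≤ size s i :=
  Finset.le_sup' _ (Finset.mem_range.2 (Nat.lt_succ_of_le h))

theorem size_mono {i j : ℕ} (h : j ≤ i) : size s j ≤ size s i :=
  Finset.sup'_mono _ (Finset.range_subset_range.2 (by omega)) _

theorem size_le {i : ℕ} {c : ℝ} (h : ∀ j ≤ i, demand s j ≤ c) : size s i ≤ c :=
  Finset.sup'_le _ _ fun j hj => h j (Nat.lt_succ_iff.1 (Finset.mem_range.1 hj))

theorem size_pos (i : ℕ) : 0 < size s i :=
  ((s i).lx_pos.trans_le ((le_max_left _ _).trans (le_max_left _ _))).trans_le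
    (demand_le_size le_rfl)

theorem size_le_scale (i : ℕ) : size s i ≤ 2 ^ phase s i := by
  exact_mod_cast Int.self_le_zpow_clog (b := 2) (by norm_num) (size s i)

theorem scale_le (i : ℕ) : (2 : ℝ) ^ phase s i ≤ 2 * size s i := by
  have h : (2 : ℝ) ^ (phase s i - 1) < size s i := by
    exact_mod_cast Int.zpow_pred_clog_lt_self (b := 2) (by norm_num) (size_pos i)
  rw [zpow_sub_one₀ (by norm_num)] at h
  linarith

theorem phase_mono {i j : ℕ} (h : j ≤ i) : phase s j ≤ phase s i :=
  Int.clog_mono_right (size_pos j) (size_mono h)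

theorem fits (i : ℕ) : ∀ j < i + 1, ShelfPack.Fits (2 ^ phase s i) (2 ^ phase s i)
    (profile (s j)) := by
  intro j hj
  have h := (demand_le_size (s := s) (Nat.lt_succ_iff.1 hj)).trans (size_le_scale i)
  have h1 : (s j).lx ≤ demand s j := (le_max_left _ _).trans (le_max_left _ _)
  have h2 : (s j).ly ≤ demand s j := (le_max_right _ _).trans (le_max_left _ _)
  exact ⟨(s j).lx_pos, h1.trans h, (s j).ly_pos, h2.trans h, (s j).wx_pos.le, (s j).wy_pos.le⟩

theorem area_bound (i : ℕ) : ∑ j ∈ Finset.range (i + 1),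
    ((profile (s j)).wx * (profile (s j)).ly + (profile (s j)).wy * (profile (s j)).lx) ≤
      2 * (1 * 2 ^ phase s i * 2 ^ phase s i) := by
  have h1 : √(∑ j ∈ Finset.range i, (s j).area + (s i).area) ≤ 2 ^ phase s i :=
    ((le_max_right _ _).trans (demand_le_size le_rfl)).trans (size_le_scale i)
  rw [← Finset.sum_range_succ, Real.sqrt_le_left (by positivity)] at h1
  calc _ ≤ ∑ j ∈ Finset.range (i + 1), 2 * (s j).area := by
        refine Finset.sum_le_sum fun j _ => ?_
        have h2 := (s j).wx_mul_ly_le_area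
        have h3 := (s j).lx_mul_wy_le_area
        simp only [profile]
        linarith
    _ = 2 * ∑ j ∈ Finset.range (i + 1), (s j).area := by rw [Finset.mul_sum]
    _ ≤ _ := by linarith

theorem place_bounds (i : ℕ) :
    (40 * 2 ^ phase s i ≤ (place s i).1 ∧ (place s i).1 + (s i).lx ≤ 43 * 2 ^ phase s i) ∧
      0 ≤ (place s i).2 ∧ (place s i).2 + (s i).ly ≤ 40 * 2 ^ phase s i := by
  have hc : (0 : ℝ) < 2 ^ phase s i := by positivity
  obtain ⟨⟨h1, h2⟩, h3, h4⟩ := ShelfPack.pos_bounds hc hc one_pos le_rfl (fits i)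
    (area_bound i) (Nat.lt_succ_self i)
  simp only [profile] at h1 h2 h3 h4
  unfold place
  simp only [Prod.fst_add, Prod.snd_add]
  simp only [profile]
  refine ⟨⟨?_, ?_⟩, ?_, ?_⟩ <;> linarith

/-- Within a phase, both positions come from one virtual packing of all objects so far. A phase of
scale `c` occupies abscissas in `[40c, 43c]`, while any later one starts at `80c` or beyond. -/
theorem place_separated {i j : ℕ} (hij : i < j) :
    Precedes (profile (s i)) (place s i) (place s j) ∨
      Precedes (profile (s j)) (place s j) (place s i) := by
  have hc : (0 : ℝ) < 2 ^ phase s j := by positivity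
  rcases (phase_mono (s := s) hij.le).eq_or_lt with h | h
  · have := ShelfPack.pos_separated hc hc one_pos (fits j) hij (Nat.lt_succ_self j)
    unfold place
    rw [h]
    exact this.imp (·.translate _) (·.translate _)
  · left; left
    have h1 := (place_bounds (s := s) i).1.2
    have h2 := (place_bounds (s := s) j).1.1
    have h3 : (2 : ℝ) ^ (phase s i + 1) ≤ 2 ^ phase s j :=
      zpow_le_zpow_right₀ (by norm_num) (by omega)
    rw [zpow_add_one₀ (by norm_num)] at h3
    have : (0 : ℝ) < 2 ^ phase s i := by positivity
    simp only [profile]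
    linarith

theorem isPacking (σ : List LShape) : IsPacking Set.univ σ ((ofSeq place).run σ) :=
  isPacking_ofSeq causal_place _ σ (fun _ _ => Set.subset_univ _)
    fun _ _ _ hij => place_separated hij

theorem occupied_subset (σ : List LShape) :
    occupied σ ((ofSeq place).run σ) ⊆ Set.Icc 0 (86 * size (seq σ) (σ.length - 1)) ×ˢ
      Set.Icc 0 (80 * size (seq σ) (σ.length - 1)) := by
  refine Set.iUnion_subset fun i => ?_
  rw [run_ofSeq causal_place, ← seq_eq_get]
  refine (LShape.region_subset_box _ _).trans ?_
  obtain ⟨⟨h1, h2⟩, h3, h4⟩ := place_bounds (s := seq σ) i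
  have hi := i.2
  have h5 := (scale_le (s := seq σ) i).trans
    (mul_le_mul_of_nonneg_left (size_mono (by omega : (i : ℕ) ≤ σ.length - 1)) (by norm_num))
  have h6 : (0 : ℝ) < 2 ^ phase (seq σ) i := by positivity
  exact Set.prod_mono (Set.Icc_subset_Icc (by linarith) (by linarith))
    (Set.Icc_subset_Icc (by linarith) (by linarith))

theorem size_le_bb {σ : List LShape} (hσ : σ ≠ []) {P : Fin σ.length → ℝ × ℝ}
    (hP : IsPacking Set.univ σ P) :
    size (seq σ) (σ.length - 1) ≤ bbWidth (occupied σ P) + bbHeight (occupied σ P) := by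
  have hlen := List.length_pos_iff.2 hσ
  have hW := bbWidth_nonneg σ P
  have hH := bbHeight_nonneg σ P
  refine size_le fun j hj => max_le (max_le ?_ ?_) ?_
  · have := lx_le_bbWidth σ P ⟨j, by omega⟩
    rw [← seq_eq_get] at this
    simp only at this
    linarith
  · have := ly_le_bbHeight σ P ⟨j, by omega⟩
    rw [← seq_eq_get] at this
    simp only at this
    linarith
  · rw [← Finset.sum_range_succ]
    refine Real.sqrt_le_iff.2 ⟨by linarith, ?_⟩
    have h1 := sum_area_le hP
    have h2 : ∑ k ∈ Finset.range (j + 1), (seq σ k).area ≤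
        ∑ k ∈ Finset.range σ.length, (seq σ k).area :=
      Finset.sum_le_sum_of_subset_of_nonneg (Finset.range_subset_range.2 (by omega))
        fun k _ _ => (seq σ k).area_pos.le
    nlinarith

/-- Here the bound 1 on arm lengths enters; it is what makes the additive constant suffice for area
packing. -/
theorem size_sq_le {σ : List LShape} (hσ : σ ≠ []) :
    size (seq σ) (σ.length - 1) ^ 2 ≤ 1 + ∑ j ∈ Finset.range σ.length, (seq σ j).area := by
  have hlen := List.length_pos_iff.2 hσ
  have h0 : 0 ≤ ∑ j ∈ Finset.range σ.length, (seq σ j).area :=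
    Finset.sum_nonneg fun k _ => (seq σ k).area_pos.le
  rw [← Real.le_sqrt (size_pos _).le (by linarith)]
  refine size_le fun j hj => max_le (max_le ?_ ?_) ?_
  · exact (seq σ j).lx_le_one.trans (Real.one_le_sqrt.2 (by linarith))
  · exact (seq σ j).ly_le_one.trans (Real.one_le_sqrt.2 (by linarith))
  · rw [← Finset.sum_range_succ]
    refine Real.sqrt_le_sqrt ?_
    have h2 : ∑ k ∈ Finset.range (j + 1), (seq σ k).area ≤
        ∑ k ∈ Finset.range σ.length, (seq σ k).area :=
      Finset.sum_le_sum_of_subset_of_nonneg (Finset.range_subset_range.2 (by omega))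
        fun k _ _ => (seq σ k).area_pos.le
    linarith

end Doubling

/-! ### Competitive ratios for perimeter and area -/

theorem occupied_nil (P : Fin ([] : List LShape).length → ℝ × ℝ) : occupied [] P = ∅ :=
  Set.iUnion_eq_empty.2 fun i => i.elim0

/-- The packing `P₀` makes the set of costs nonempty; the real infimum of the empty set would be 0.
-/
theorem le_opt {V : Variant} {σ : List LShape} {c : ℝ} {P₀ : Fin σ.length → ℝ × ℝ}
    (h₀ : IsPacking V.container σ P₀)
    (h : ∀ P, IsPacking V.container σ P → c ≤ V.cost (occupied σ P)) : c ≤ V.opt σ := by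
  refine le_csInf ⟨_, P₀, h₀, rfl⟩ ?_
  rintro _ ⟨P, hP, rfl⟩
  exact h P hP

theorem exists_periPack_competitive : ∃ (C : ℝ) (𝒜 : OnlineAlgorithm), periPack.Solves 𝒜 ∧
    periPack.HasCompetitiveRatio 𝒜 (fun _ => C) := by
  refine ⟨166, ofSeq Doubling.place, Doubling.isPacking, fun σ => ?_⟩
  have hcost : ∀ P : Fin σ.length → ℝ × ℝ, 0 ≤ periPack.cost (occupied σ P) := fun P =>
    mul_nonneg zero_le_two (add_nonneg (bbWidth_nonneg σ P) (bbHeight_nonneg σ P))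
  rcases eq_or_ne σ [] with rfl | hσ
  · have h0 : periPack.algCost (ofSeq Doubling.place) [] = 0 := by
      simp [Variant.algCost, occupied_nil, periPack, bbWidth, bbHeight]
    rw [h0]
    have := le_opt (V := periPack) (Doubling.isPacking []) fun P _ => hcost P
    positivity
  · have h1 := le_opt (V := periPack) (c := 2 * Doubling.size (seq σ) (σ.length - 1))
      (Doubling.isPacking σ) fun P hP =>
        mul_le_mul_of_nonneg_left (Doubling.size_le_bb hσ hP) zero_le_two
    have hs := Doubling.size_pos (s := seq σ) (σ.length - 1)
    have h2 := bbWidth_le (Doubling.occupied_subset σ) (by linarith)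
    have h3 := bbHeight_le (Doubling.occupied_subset σ) (by linarith)
    have h4 : periPack.algCost (ofSeq Doubling.place) σ =
      2 * (bbWidth (occupied σ ((ofSeq Doubling.place).run σ)) +
        bbHeight (occupied σ ((ofSeq Doubling.place).run σ))) := rfl
    rw [h4]
    linarith

/-- The cost is at most `86 * 80 * size ^ 2`, hence at most `6880 * (1 + OPT)`. The factor `√n` is
used only through `√n ≥ 1`. -/
theorem exists_areaPack_competitive : ∃ (C : ℝ) (𝒜 : OnlineAlgorithm), areaPack.Solves 𝒜 ∧
    areaPack.HasAsymptoticCompetitiveRatio 𝒜 (fun n => C * √n) := by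
  refine ⟨6880, ofSeq Doubling.place, Doubling.isPacking, 6880, by norm_num, fun σ => ?_⟩
  rcases eq_or_ne σ [] with rfl | hσ
  · have h0 : areaPack.algCost (ofSeq Doubling.place) [] = 0 := by
      simp [Variant.algCost, occupied_nil, areaPack, bbWidth, bbHeight]
    rw [h0]
    simp
  · have h1 := le_opt (V := areaPack) (Doubling.isPacking σ) fun P hP => sum_area_le hP
    have h0 : 0 ≤ ∑ j ∈ Finset.range σ.length, (seq σ j).area :=
      Finset.sum_nonneg fun k _ => (seq σ k).area_pos.le
    have hs := Doubling.size_pos (s := seq σ) (σ.length - 1)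
    have h2 := bbWidth_le (Doubling.occupied_subset σ) (by linarith)
    have h3 := bbHeight_le (Doubling.occupied_subset σ) (by linarith)
    have h4 : areaPack.algCost (ofSeq Doubling.place) σ =
      bbWidth (occupied σ ((ofSeq Doubling.place).run σ)) *
        bbHeight (occupied σ ((ofSeq Doubling.place).run σ)) := rfl
    have h5 := mul_le_mul h2 h3 (bbHeight_nonneg σ _) (by linarith)
    have h6 := Doubling.size_sq_le hσ
    have h7 : (1 : ℝ) ≤ √σ.length :=
      Real.one_le_sqrt.2 (by exact_mod_cast List.length_pos_iff.2 hσ)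
    have h8 := mul_le_mul_of_nonneg_right h7 (h0.trans h1)
    rw [h4]
    linarith

end LPacking

/-! ### Packing into the unit square -/

namespace LPacking

/-- Reflection of a profile in the diagonal. -/
def Profile.swap (p : Profile) : Profile := ⟨p.ly, p.lx, p.wy, p.wx⟩

theorem Precedes.swap {s : Profile} {p q : ℝ × ℝ} (h : Precedes s p q) :
    Precedes s.swap p.swap q.swap := by
  rcases h with h | h | ⟨h, h'⟩
  · exact Or.inr (Or.inl h)
  · exact Or.inl h
  · exact Or.inr (Or.inr ⟨h', h⟩)

namespace SquarePack

variable (δ : ℝ)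

/-- The bound on the short arm of thin objects. -/
noncomputable def thin : ℝ := δ ^ 2 / 640

/-- Objects with a short vertical arm; other objects are replaced by one of area zero. -/
noncomputable def wide (L : LShape) : Profile :=
  if L.ly ≤ thin δ then profile L else ⟨1 - δ, thin δ, 0, 0⟩

/-- The reflections of the other objects with a short horizontal arm. -/
noncomputable def tall (L : LShape) : Profile :=
  if ¬ L.ly ≤ thin δ ∧ L.lx ≤ thin δ then (profile L).swap else ⟨1 - δ, thin δ, 0, 0⟩

/-- The thicknesses of the arms of objects with two long arms, and zero for other objects. -/
noncomputable def thickness (L : LShape) : ℝ × ℝ :=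
  if L.ly ≤ thin δ ∨ L.lx ≤ thin δ then 0 else (L.wx, L.wy)

/-- Wide objects go to a strip at the bottom, tall ones to a strip at the left, and those with
two long arms are nested. -/
noncomputable def place (s : ℕ → LShape) (i : ℕ) : ℝ × ℝ :=
  if (s i).ly ≤ thin δ then
    (δ / 4, 0) + ShelfPack.pos (1 - δ) (thin δ) (δ / 4) (fun j => wide δ (s j)) i
  else if (s i).lx ≤ thin δ then
    (0, δ / 4) + (ShelfPack.pos (1 - δ) (thin δ) (δ / 4) (fun j => tall δ (s j)) i).swap
  else
    (δ / 4 + ∑ j ∈ Finset.range i, (thickness δ (s j)).1,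
      δ / 4 + ∑ j ∈ Finset.range i, (thickness δ (s j)).2)

theorem causal_place : Causal (place δ) := by
  intro s s' i h
  have h1 := (ShelfPack.causal_pos (1 - δ) (thin δ) (δ / 4)).precomp
    (causal_eval.comp (wide δ)) s s' i h
  have h2 := (ShelfPack.causal_pos (1 - δ) (thin δ) (δ / 4)).precomp
    (causal_eval.comp (tall δ)) s s' i h
  have h3 := (causal_eval.comp fun L => (thickness δ L).1).sum_range s s' i h
  have h4 := (causal_eval.comp fun L => (thickness δ L).2).sum_range s s' i h
  simp only at h1 h2 h3 h4
  unfold place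
  rw [h i le_rfl, h1, h2, h3, h4]

variable {δ} {s : ℕ → LShape} {N : ℕ}

theorem thin_pos (h0 : 0 < δ) : 0 < thin δ := by unfold thin; positivity

theorem area_bound (h0 : 0 < δ) (h1 : δ ≤ 1 / 2)
    (hA : ∑ j ∈ Finset.range N, (s j).area ≤ thin δ * δ / 8) {f : LShape → Profile}
    (hf : ∀ L, (f L).wx * (f L).ly + (f L).wy * (f L).lx ≤ 2 * L.area) :
    ∑ j ∈ Finset.range N, ((f (s j)).wx * (f (s j)).ly + (f (s j)).wy * (f (s j)).lx) ≤
      2 * (δ / 4 * (1 - δ) * thin δ) := by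
  calc _ ≤ ∑ j ∈ Finset.range N, 2 * (s j).area := Finset.sum_le_sum fun j _ => hf _
    _ = 2 * ∑ j ∈ Finset.range N, (s j).area := by rw [Finset.mul_sum]
    _ ≤ 2 * (thin δ * δ / 8) := by gcongr
    _ ≤ _ := by
      have := mul_le_mul_of_nonneg_left (show 1 / 2 ≤ 1 - δ by linarith)
        (mul_pos h0 (thin_pos h0)).le
      linarith

theorem wide_area (L : LShape) :
    (wide δ L).wx * (wide δ L).ly + (wide δ L).wy * (wide δ L).lx ≤ 2 * L.area := by
  have h2 := L.wx_mul_ly_le_area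
  have h3 := L.lx_mul_wy_le_area
  unfold wide
  split_ifs
  · simp only [profile]; linarith
  · have := L.area_pos; simp only; linarith

theorem tall_area (L : LShape) :
    (tall δ L).wx * (tall δ L).ly + (tall δ L).wy * (tall δ L).lx ≤ 2 * L.area := by
  have h2 := L.wx_mul_ly_le_area
  have h3 := L.lx_mul_wy_le_area
  unfold tall
  split_ifs
  · simp only [profile, Profile.swap]; linarith
  · have := L.area_pos; simp only; linarith

/-- The stand-in for objects treated elsewhere has legal arm lengths and thickness zero, so it keeps
the indices aligned without adding load. -/
theorem wide_fits (h0 : 0 < δ) (h1 : δ ≤ 1 / 2) {L : LShape} (hx : L.lx ≤ 1 - δ) :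
    ShelfPack.Fits (1 - δ) (thin δ) (wide δ L) := by
  have := thin_pos h0
  unfold wide
  split_ifs with h
  · exact ⟨L.lx_pos, hx, L.ly_pos, h, L.wx_pos.le, L.wy_pos.le⟩
  · exact ⟨by simp only; linarith, le_rfl, this, le_rfl, le_rfl, le_rfl⟩

theorem tall_fits (h0 : 0 < δ) (h1 : δ ≤ 1 / 2) {L : LShape} (hy : L.ly ≤ 1 - δ) :
    ShelfPack.Fits (1 - δ) (thin δ) (tall δ L) := by
  have := thin_pos h0
  unfold tall
  split_ifs with h
  · exact ⟨L.ly_pos, hy, L.lx_pos, h.2, L.wy_pos.le, L.wx_pos.le⟩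
  · exact ⟨by simp only; linarith, le_rfl, this, le_rfl, le_rfl, le_rfl⟩

/-- With `η = δ/4`, the shelves fit into length `1 - δ/4`, which remains beside the other strip. The
constant 640 in `thin` makes the strip exactly `δ/4` thick. -/
theorem strip_dimensions (h0 : 0 < δ) :
    (1 + 2 * (δ / 4)) * (1 - δ) ≤ 1 - δ / 4 ∧ 40 / (δ / 4) * thin δ = δ / 4 := by
  constructor
  · nlinarith
  · unfold thin; field_simp; norm_num

theorem thickness_nonneg (L : LShape) : 0 ≤ (thickness δ L).1 ∧ 0 ≤ (thickness δ L).2 := by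
  unfold thickness
  split_ifs
  · exact ⟨le_rfl, le_rfl⟩
  · exact ⟨L.wx_pos.le, L.wy_pos.le⟩

/-- An arm longer than `thin δ` carries area at least its thickness times `thin δ`; hence the total
thickness of the nested objects is small. -/
theorem thickness_le (L : LShape) :
    (thickness δ L).1 * thin δ ≤ L.area ∧ (thickness δ L).2 * thin δ ≤ L.area := by
  have := L.area_pos
  unfold thickness
  split_ifs with h
  · simp [this.le]
  · push Not at h
    refine ⟨le_trans ?_ L.wx_mul_ly_le_area, le_trans ?_ L.lx_mul_wy_le_area⟩
    · exact mul_le_mul_of_nonneg_left h.1.le L.wx_pos.le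
    · simp only
      rw [mul_comm]
      exact mul_le_mul_of_nonneg_right h.2.le L.wy_pos.le

theorem sum_thickness_le (h0 : 0 < δ) (hA : ∑ j ∈ Finset.range N, (s j).area ≤ thin δ * δ / 8)
    {w : LShape → ℝ} (hw : ∀ L, 0 ≤ w L) (hwA : ∀ L : LShape, w L * thin δ ≤ L.area) {i : ℕ}
    (hi : i ≤ N) : ∑ j ∈ Finset.range i, w (s j) ≤ δ / 8 := by
  have h1 : ∑ j ∈ Finset.range i, w (s j) ≤ ∑ j ∈ Finset.range N, w (s j) :=
    Finset.sum_le_sum_of_subset_of_nonneg (Finset.range_subset_range.2 hi) fun _ _ _ => hw _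
  have h2 : (∑ j ∈ Finset.range N, w (s j)) * thin δ ≤ δ / 8 * thin δ := by
    rw [Finset.sum_mul]
    refine (Finset.sum_le_sum fun j _ => hwA (s j)).trans (hA.trans (le_of_eq ?_))
    ring
  exact h1.trans (le_of_mul_le_mul_right h2 (thin_pos h0))

theorem place_wide (h0 : 0 < δ) (h1 : δ ≤ 1 / 2)
    (hs : ∀ j < N, (s j).lx ≤ 1 - δ ∧ (s j).ly ≤ 1 - δ)
    (hA : ∑ j ∈ Finset.range N, (s j).area ≤ thin δ * δ / 8) {i : ℕ} (hi : i < N)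
    (h : (s i).ly ≤ thin δ) :
    (δ / 4 ≤ (place δ s i).1 ∧ (place δ s i).1 + (s i).lx ≤ 1) ∧
      0 ≤ (place δ s i).2 ∧ (place δ s i).2 + (s i).ly ≤ δ / 4 := by
  obtain ⟨⟨b1, b2⟩, b3, b4⟩ := ShelfPack.pos_bounds (s := fun j => wide δ (s j)) (by linarith)
    (thin_pos h0) (by linarith) (by linarith) (fun j hj => wide_fits h0 h1 (hs j hj).1)
    (area_bound h0 h1 hA wide_area) hi
  obtain ⟨d1, d2⟩ := strip_dimensions h0
  have e1 : (wide δ (s i)).lx = (s i).lx := by rw [wide, if_pos h]; rfl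
  have e2 : (wide δ (s i)).ly = (s i).ly := by rw [wide, if_pos h]; rfl
  rw [e1] at b2
  rw [e2] at b4
  rw [place, if_pos h]
  simp only [Prod.fst_add, Prod.snd_add]
  refine ⟨⟨?_, ?_⟩, ?_, ?_⟩ <;> linarith

theorem place_tall (h0 : 0 < δ) (h1 : δ ≤ 1 / 2)
    (hs : ∀ j < N, (s j).lx ≤ 1 - δ ∧ (s j).ly ≤ 1 - δ)
    (hA : ∑ j ∈ Finset.range N, (s j).area ≤ thin δ * δ / 8) {i : ℕ} (hi : i < N)
    (h : ¬ (s i).ly ≤ thin δ) (h' : (s i).lx ≤ thin δ) :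
    (0 ≤ (place δ s i).1 ∧ (place δ s i).1 + (s i).lx ≤ δ / 4) ∧
      δ / 4 ≤ (place δ s i).2 ∧ (place δ s i).2 + (s i).ly ≤ 1 := by
  obtain ⟨⟨b1, b2⟩, b3, b4⟩ := ShelfPack.pos_bounds (s := fun j => tall δ (s j)) (by linarith)
    (thin_pos h0) (by linarith) (by linarith) (fun j hj => tall_fits h0 h1 (hs j hj).2)
    (area_bound h0 h1 hA tall_area) hi
  obtain ⟨d1, d2⟩ := strip_dimensions h0
  have e1 : (tall δ (s i)).lx = (s i).ly := by rw [tall, if_pos ⟨h, h'⟩]; rfl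
  have e2 : (tall δ (s i)).ly = (s i).lx := by rw [tall, if_pos ⟨h, h'⟩]; rfl
  rw [e1] at b2
  rw [e2] at b4
  rw [place, if_neg h, if_pos h']
  simp only [Prod.fst_add, Prod.snd_add, Prod.fst_swap, Prod.snd_swap]
  refine ⟨⟨?_, ?_⟩, ?_, ?_⟩ <;> linarith

theorem place_big (h0 : 0 < δ)
    (hs : ∀ j < N, (s j).lx ≤ 1 - δ ∧ (s j).ly ≤ 1 - δ)
    (hA : ∑ j ∈ Finset.range N, (s j).area ≤ thin δ * δ / 8) {i : ℕ} (hi : i < N)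
    (h : ¬ (s i).ly ≤ thin δ) (h' : ¬ (s i).lx ≤ thin δ) :
    (δ / 4 ≤ (place δ s i).1 ∧ (place δ s i).1 + (s i).lx ≤ 1) ∧
      δ / 4 ≤ (place δ s i).2 ∧ (place δ s i).2 + (s i).ly ≤ 1 := by
  have b1 := sum_thickness_le h0 hA (fun L => (thickness_nonneg (δ := δ) L).1)
    (fun L => (thickness_le L).1) hi.le
  have b2 := sum_thickness_le h0 hA (fun L => (thickness_nonneg (δ := δ) L).2)
    (fun L => (thickness_le L).2) hi.le
  have b3 := Finset.sum_nonneg fun j (_ : j ∈ Finset.range i) =>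
    (thickness_nonneg (δ := δ) (s j)).1
  have b4 := Finset.sum_nonneg fun j (_ : j ∈ Finset.range i) =>
    (thickness_nonneg (δ := δ) (s j)).2
  have := hs i hi
  rw [place, if_neg h, if_neg h']
  simp only at b1 b2 ⊢
  refine ⟨⟨?_, ?_⟩, ?_, ?_⟩ <;> linarith

theorem place_separated (h0 : 0 < δ) (h1 : δ ≤ 1 / 2)
    (hs : ∀ j < N, (s j).lx ≤ 1 - δ ∧ (s j).ly ≤ 1 - δ)
    (hA : ∑ j ∈ Finset.range N, (s j).area ≤ thin δ * δ / 8) {i j : ℕ} (hij : i < j)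
    (hj : j < N) :
    Precedes (profile (s i)) (place δ s i) (place δ s j) ∨
      Precedes (profile (s j)) (place δ s j) (place δ s i) := by
  have hi : i < N := hij.trans hj
  by_cases wi : (s i).ly ≤ thin δ <;> by_cases wj : (s j).ly ≤ thin δ
  · have := ShelfPack.pos_separated (s := fun j => wide δ (s j)) (X := 1 - δ) (η := δ / 4)
      (by linarith) (thin_pos h0) (by linarith) (fun j hj => wide_fits h0 h1 (hs j hj).1) hij hj
    have e1 : wide δ (s i) = profile (s i) := if_pos wi
    have e2 : wide δ (s j) = profile (s j) := if_pos wj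
    simp only [e1, e2] at this
    rw [place, place, if_pos wi, if_pos wj]
    exact this.imp (·.translate _) (·.translate _)
  · have b1 := place_wide h0 h1 hs hA hi wi
    by_cases tj : (s j).lx ≤ thin δ
    · have b2 := place_tall h0 h1 hs hA hj wj tj
      exact Or.inr (Or.inl (b2.1.2.trans b1.1.1))
    · have b2 := place_big h0 hs hA hj wj tj
      exact Or.inl (Or.inr (Or.inl (b1.2.2.trans b2.2.1)))
  · have b1 := place_wide h0 h1 hs hA hj wj
    by_cases ti : (s i).lx ≤ thin δ
    · have b2 := place_tall h0 h1 hs hA hi wi ti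
      exact Or.inl (Or.inl (b2.1.2.trans b1.1.1))
    · have b2 := place_big h0 hs hA hi wi ti
      exact Or.inr (Or.inr (Or.inl (b1.2.2.trans b2.2.1)))
  · by_cases ti : (s i).lx ≤ thin δ <;> by_cases tj : (s j).lx ≤ thin δ
    · have := ShelfPack.pos_separated (s := fun j => tall δ (s j)) (X := 1 - δ) (η := δ / 4)
        (by linarith) (thin_pos h0) (by linarith) (fun j hj => tall_fits h0 h1 (hs j hj).2) hij hj
      have e1 : tall δ (s i) = (profile (s i)).swap := if_pos ⟨wi, ti⟩
      have e2 : tall δ (s j) = (profile (s j)).swap := if_pos ⟨wj, tj⟩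
      simp only [e1, e2] at this
      rw [place, place, if_neg wi, if_neg wj, if_pos ti, if_pos tj]
      exact this.imp (·.swap.translate _) (·.swap.translate _)
    · have b1 := place_tall h0 h1 hs hA hi wi ti
      have b2 := place_big h0 hs hA hj wj tj
      exact Or.inl (Or.inl (b1.1.2.trans b2.1.1))
    · have b1 := place_tall h0 h1 hs hA hj wj tj
      have b2 := place_big h0 hs hA hi wi ti
      exact Or.inr (Or.inl (b1.1.2.trans b2.1.1))
    · left; right; right
      have e : thickness δ (s i) = ((s i).wx, (s i).wy) := if_neg (by tauto)
      have hle : ∀ {w : LShape → ℝ}, (∀ L, 0 ≤ w L) →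
          ∑ k ∈ Finset.range i, w (s k) + w (s i) ≤ ∑ k ∈ Finset.range j, w (s k) := by
        intro w hw
        rw [← Finset.sum_range_succ (fun k => w (s k))]
        exact Finset.sum_le_sum_of_subset_of_nonneg (Finset.range_subset_range.2 hij)
          fun _ _ _ => hw _
      have l1 := hle fun L => (thickness_nonneg (δ := δ) L).1
      have l2 := hle fun L => (thickness_nonneg (δ := δ) L).2
      simp only [e] at l1 l2
      rw [place, place, if_neg wi, if_neg wj, if_neg ti, if_neg tj]
      simp only [profile]
      constructor <;> linarith

theorem packsUnitSquare (h0 : 0 < δ) (h1 : δ ≤ 1 / 2) :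
    PacksUnitSquare (ofSeq (place δ)) (1 - δ) (thin δ * δ / 8) := by
  intro σ hσ hA
  rw [sum_area_eq] at hA
  have hs : ∀ j < σ.length, (seq σ j).lx ≤ 1 - δ ∧ (seq σ j).ly ≤ 1 - δ := by
    intro j hj
    rw [seq_eq_get σ ⟨j, hj⟩]
    exact hσ _ (List.get_mem _ _)
  refine isPacking_ofSeq (causal_place δ) _ σ (fun i hi => ?_)
    fun j hj i hij => place_separated h0 h1 hs hA hij hj
  refine (LShape.region_subset_box _ _).trans
    (Set.prod_mono (Set.Icc_subset_Icc ?_ ?_) (Set.Icc_subset_Icc ?_ ?_))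
  all_goals
    by_cases w : (seq σ i).ly ≤ thin δ
    · have := place_wide h0 h1 hs hA hi w
      linarith
    · by_cases t : (seq σ i).lx ≤ thin δ
      · have := place_tall h0 h1 hs hA hi w t
        linarith
      · have := place_big h0 hs hA hi w t
        linarith

end SquarePack

/-! ### The critical density -/

theorem onlineCriticalDensity_pos {t : ℝ} (ht : t < 1) : 0 < onlineCriticalDensity t := by
  -- The cap `1/2` keeps `1 - δ` bounded below, whatever `t` is.
  obtain ⟨δ, hδ⟩ : ∃ δ, δ = min (1 - t) (1 / 2) := ⟨_, rfl⟩
  have h0 : 0 < δ := hδ ▸ lt_min (by linarith) (by norm_num)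
  have h1 : δ ≤ 1 / 2 := hδ ▸ min_le_right _ _
  have h2 : δ ≤ 1 - t := hδ ▸ min_le_left _ _
  have hA : 0 < SquarePack.thin δ * δ / 8 := by
    have := SquarePack.thin_pos h0
    positivity
  refine lt_of_lt_of_le (ENNReal.coe_pos.2 (Real.toNNReal_pos.2 hA))
    (le_iSup₂ (f := fun (A : ℝ≥0)
      (_ : A ∈ {A : ℝ≥0 | ∃ 𝒜 : OnlineAlgorithm, PacksUnitSquare 𝒜 t A}) => (A : ℝ≥0∞))
      (SquarePack.thin δ * δ / 8).toNNReal ⟨ofSeq (SquarePack.place δ), fun σ hσ hσA => ?_⟩)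
  rw [Real.coe_toNNReal _ hA.le] at hσA
  refine SquarePack.packsUnitSquare h0 h1 σ (fun L hL => ?_) hσA
  have := hσ L hL
  constructor <;> linarith

theorem onlineCriticalDensity_one : onlineCriticalDensity 1 = 0 := by
  refine le_antisymm (iSup₂_le fun A hA => ?_) zero_le
  obtain ⟨𝒜, h⟩ := hA
  by_contra! hpos
  have hA0 : (0 : ℝ) < A := by exact_mod_cast hpos
  obtain ⟨w, hw⟩ : ∃ w, w = min ((A : ℝ) / 4) 1 := ⟨_, rfl⟩
  have hw0 : 0 < w := hw ▸ lt_min (by linarith) one_pos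
  have hw1 : w ≤ 1 := hw ▸ min_le_right _ _
  have hwA : w ≤ A / 4 := hw ▸ min_le_left _ _
  let L : LShape := ⟨1, 1, w, w, hw0, hw0, hw1, hw1, le_rfl, le_rfl⟩
  -- Two copies have total area `4w - 2w²`, below `A` since `w ≤ A/4`. Unit arms pin both corners to
  -- the origin.
  have hP := h [L, L] (by simp [L]) (by
    have := mul_pos hw0 hw0
    simp only [List.map_cons, List.map_nil, List.sum_cons, List.sum_nil, LShape.area, L]
    linarith)
  have hcorner : ∀ i : Fin [L, L].length, 𝒜.run [L, L] i = 0 := by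
    intro i
    have hget : [L, L].get i = L := by fin_cases i <;> rfl
    have h1 := hP.1 i (LShape.corner_mem_region _ _)
    have h2 := hP.1 i (LShape.right_mem_region _ _)
    have h3 := hP.1 i (LShape.top_mem_region _ _)
    rw [hget] at h2 h3
    have a1 := h1.1.1
    have a2 := h1.2.1
    have a3 : _ + (1 : ℝ) ≤ 1 := h2.1.2
    have a4 : _ + (1 : ℝ) ≤ 1 := h3.2.2
    exact Prod.ext (le_antisymm (by simpa using a3) a1) (le_antisymm (by simpa using a4) a2)
  have hd := hP.2 (show (⟨0, by simp⟩ : Fin [L, L].length) ≠ ⟨1, by simp⟩ by simp)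
  simp only [hcorner] at hd
  refine not_disjoint_of_point (LShape.foot_subset_interior L 0) (LShape.foot_subset_interior L 0)
    ?_ ?_ hd <;> simp [L, hw0]

end LPacking

theorem corollary1p4 :
    -- (i) strip packing
    (∃ c : ℝ, 0 < c ∧ ∀ 𝒜 : LPacking.OnlineAlgorithm, LPacking.stripPack.Solves 𝒜 →
      ∀ f : ℕ → ℝ, LPacking.stripPack.HasAsymptoticCompetitiveRatio 𝒜 f →
        ∀ᶠ n : ℕ in Filter.atTop, c * (n / Real.log n) ≤ f n) ∧
    -- (ii) perimeter packing
    (∃ (C : ℝ) (𝒜 : LPacking.OnlineAlgorithm), LPacking.periPack.Solves 𝒜 ∧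
      LPacking.periPack.HasCompetitiveRatio 𝒜 (fun _ => C)) ∧
    -- (iii) area packing
    (∃ (C : ℝ) (𝒜 : LPacking.OnlineAlgorithm), LPacking.areaPack.Solves 𝒜 ∧
      LPacking.areaPack.HasAsymptoticCompetitiveRatio 𝒜 (fun n => C * √n)) ∧
    -- (iv) critical packing density
    ((∀ t : ℝ, t < 1 → 0 < LPacking.onlineCriticalDensity t) ∧
      LPacking.onlineCriticalDensity 1 = 0) :=
  ⟨LPacking.strip_lower_bound, LPacking.exists_periPack_competitive,
    LPacking.exists_areaPack_competitive, fun _ => LPacking.onlineCriticalDensity_pos,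
    LPacking.onlineCriticalDensity_one⟩
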